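/- A *descending plane partition* is a (possibly empty) array $\pi$ of positive integers with rows $\pi_{i,i},\pi_{i,i+1},\dots,\pi_{i,\lambda_i}$ ($1\le i\le k$) such that $\lambda_1\ge\lambda_2\ge\dots\ge\lambda_k\ge k$, entries decrease weakly along rows and strictly along columns, and the first entry of each row does not exceed the number of entries of the preceding row but is greater than the number of entries of its own row. For $\pi$ with entries $\le n$, let $r(\pi)$ be the number of entries equal to $n$, $s(\pi)$ the number of entries with $\pi_{i,j}\le j-i$, and $i(\pi)$ the total number of entries. Let $n\ge1$, $u=(\sqrt3/2,-1/2)$, $v=(0,1)$, and write $(x,y)$ for the point $xu+yv$ of the plane. Let $H_n$ be the hexagon with vertices $(0,n+1),(n-1,n+1),(n-1,0),(0,1-n),(-n-1,1-n),(-n-1,0)$; it has angles $120^\circ$ and side lengths $n-1,n+1,n-1,n+1,n-1,n+1$. Remove from its centre the equilateral triangle of side length $2$ with vertices $(0,0),(0,2),(-2,0)$. A *rhombus* is the union of two unit triangles of the triangular lattice $\mathbb Zu+\mathbb Zv$ that share a side; it is *horizontal* if its sides are parallel to $u$ and $u+v$, and *rising* if its sides are parallel to $v$ and $u+v$. A rhombus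 tiling of the region is *cyclically symmetric* if it is invariant under rotation by $120^\circ$ about the centre of $H_n$. The *fundamental region* is the parallelogram $0\le x\le n-1$, $0\le y\le n+1$; its left border is $x=0$ and its bottom border is $y=0$. Given a cyclically symmetric tiling $T$, consider the rhombi of $T$ that lie in the fundamental region or are cut in two by its borders. Connect the midpoints of the two edges parallel to $u+v$ of each horizontal and each rising rhombus among them; with the midpoint of the edge from $(x,y)$ to $(x+1,y+1)$ regarded as the lattice point $(x,y)$, horizontal rhombi give unit steps to the right and rising rhombi give unit steps downwards. In this way the rhombi cut by the left border are connected with the rhombi cut by the bottom border by a uniquely determined family of lattice paths. These paths are pairwise non-intersecting (no two have a point in common); each runs from $(0,x+2)$ to $(x,0)$ for some integer $x\ge0$; every rhombus cut by the left border gives the starting point of a path, and every rhombus cut by the bottom border gives the endpoint of a path. Let each path, in the order of decreasing starting heights, contribute the row consisting of the height of its starting point followed by the heights of its horizontal steps of positive height. Then this defines a bijection from the cyclically symmetric rhombus tilings of $H_n$ with the central triangle removed onto the descending plane partitions with entries $\le n$. If $\pi$ corresponds to $T$, then * $r(\pi)$ is the number of horizontal rhombi of $T$ in the top strip $n\le y\le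 n+1$ of the fundamental region (including one that is cut by the left border); * $s(\pi)$ is the number of horizontal rhombi of $T$ in the wedge $1\le y\le x+1$, which is bounded by the rays in directions $u$ and $u+v$ from the midpoint $(0,1)$ of the vertical side of the removed triangle; * $i(\pi)$ is the number of horizontal rhombi of $T$ in the fundamental region, including those cut by its left border, but not counting those that have a side on its bottom border. -/

import Mathlib

namespace DescendingPP

/-! ### Descending plane partitions -/

/-- An array `π` with rows `π_{i,i}, π_{i,i+1}, …, π_{i,λ_i}` (`1 ≤ i ≤ k`) is stored as the list of
its rows, each row as the list of its entries.  With indices starting at `0`, the entry `D[i][t]`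
is `π_{i+1, i+1+t}`, and `λ_{i+1} = i + D[i].length`.  The empty array (`k = 0`) is allowed. -/
structure IsDescending (D : List (List ℤ)) : Prop where
  /-- the entries are positive integers -/
  pos : ∀ row ∈ D, ∀ a ∈ row, 0 < a
  /-- `λ_1 ≥ λ_2 ≥ … ≥ λ_k` -/
  shape : ∀ (i : ℕ) (h : i + 1 < D.length), (i + 1) + D[i + 1].length ≤ i + D[i].length
  /-- `λ_k ≥ k` -/
  shape_last : ∀ (i : ℕ) (h : i < D.length), i + 1 = D.length → D.length ≤ i + D[i].length
  /-- the entries along rows are weakly decreasing -/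
  rows : ∀ row ∈ D, row.Pairwise (fun a b => b ≤ a)
  /-- the entries along columns are strictly decreasing -/
  cols : ∀ (i t : ℕ) (h : i + 1 < D.length) (ht : t < D[i + 1].length)
    (ht1 : t + 1 < D[i].length), D[i + 1][t] < D[i][t + 1]
  /-- the first entry in each row does not exceed the number of entries in the preceding row -/
  first_le : ∀ (i : ℕ) (h : i + 1 < D.length), ∀ a ∈ D[i + 1].head?, a ≤ (D[i].length : ℤ)
  /-- the first entry in each row is greater than the number of entries in its own row -/
  lt_first : ∀ row ∈ D, ∀ a ∈ row.head?, (row.length : ℤ) < a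

/-- Descending plane partitions all of whose entries are at most `n`. -/
def DPP (n : ℕ) : Type :=
  {D : List (List ℤ) // IsDescending D ∧ ∀ row ∈ D, ∀ a ∈ row, a ≤ (n : ℤ)}

/-- `r(π)`: the number of entries equal to `n`. -/
def statR (n : ℕ) (D : List (List ℤ)) : ℕ :=
  (D.map fun row => row.count (n : ℤ)).sum

/-- `s(π)`: the number of special entries, i.e. of entries with `π_{i,j} ≤ j - i`; the number
`j - i` is the position of the entry in its row, counted from `0`. -/
def statS (D : List (List ℤ)) : ℕ :=
  (D.map fun row => row.zipIdx.countP fun e => decide (e.1 ≤ (e.2 : ℤ))).sum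

/-- `i(π)`: the total number of entries. -/
def statI (D : List (List ℤ)) : ℕ :=
  (D.map fun row => row.length).sum

/-! ### The triangular lattice

The pair `(x, y)` stands for the point `x • u + y • v` of the plane, where, in Cartesian
coordinates, `u = (√3/2, -1/2)` and `v = (0, 1)`.  Then `u + v = (√3/2, 1/2)`, and
`±u`, `±v`, `±(u + v)` are the six unit vectors of the triangular lattice. -/

/-- Points of the triangular lattice, in the coordinates `x • u + y • v`. -/
abbrev Pt : Type := ℤ × ℤ

/-- The unit triangles of the lattice: `left p` has a vertex `p` on its left and a vertical side on
its right; `right p` has a vertical side on its left, with lower endpoint `p`. -/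
inductive Triangle where
  | left (p : Pt)
  | right (p : Pt)
  deriving DecidableEq

/-- The three vertices of a unit triangle. -/
def Triangle.vertices : Triangle → Finset Pt
  | .left p => {p, p + (1, 0), p + (1, 1)}
  | .right p => {p, p + (0, 1), p + (1, 1)}

/-- The three orientations of a unit rhombus: `horizontal` (long diagonal horizontal, sides `u`
and `u + v`), `rising` (south-west/north-east, sides `v` and `u + v`), `falling`
(north-west/south-east, sides `u` and `v`). -/
inductive Orientation where
  | horizontal
  | rising
  | falling
  deriving DecidableEq

/-- A rhombus with unit sides and angles `60°`, `120°` of the triangular lattice, i.e. the union of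
two unit triangles with a common side; it is given by its orientation and by the left vertex `p`
of the triangle `Triangle.left p` which it contains. -/
structure Rhombus where
  orientation : Orientation
  corner : Pt
  deriving DecidableEq

/-- The two unit triangles which form a rhombus. -/
def Rhombus.triangles : Rhombus → Finset Triangle
  | ⟨.horizontal, p⟩ => {.left p, .right (p + (1, 0))}
  | ⟨.rising, p⟩ => {.left p, .right (p - (0, 1))}
  | ⟨.falling, p⟩ => {.left p, .right p}

/-- The four vertices of a rhombus. -/
def Rhombus.vertices (ρ : Rhombus) : Finset Pt :=
  ρ.triangles.biUnion Triangle.vertices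

/-! ### The hexagon with triangular hole, and its tilings -/

/-- The hexagon with side lengths `n-1, n+1, n-1, n+1, n-1, n+1` and all angles `120°`.  Its
vertices are, clockwise from the top, `(0, n+1)`, `(n-1, n+1)`, `(n-1, 0)`, `(0, -(n-1))`,
`(-(n+1), -(n-1))`, `(-(n+1), 0)`. -/
def InHexagon (n : ℕ) (p : Pt) : Prop :=
  -((n : ℤ) + 1) ≤ p.1 ∧ p.1 ≤ (n : ℤ) - 1 ∧
  -((n : ℤ) - 1) ≤ p.2 ∧ p.2 ≤ (n : ℤ) + 1 ∧
  -((n : ℤ) + 1) ≤ p.1 - p.2 ∧ p.1 - p.2 ≤ (n : ℤ) - 1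

/-- The equilateral triangle with side length `2` in the centre of the hexagon; its vertices are
`(0, 0)`, `(0, 2)`, `(-2, 0)`. -/
def InHole (p : Pt) : Prop :=
  p.1 ≤ 0 ∧ 0 ≤ p.2 ∧ p.2 ≤ p.1 + 2

/-- The unit triangle `t` lies in the hexagon and not in the removed central triangle. -/
def InRegion (n : ℕ) (t : Triangle) : Prop :=
  (∀ p ∈ t.vertices, InHexagon n p) ∧ ¬ ∀ p ∈ t.vertices, InHole p

/-- `T` is (the set of tiles of) a rhombus tiling of the hexagon with triangular hole. -/
def IsTiling (n : ℕ) (T : Finset Rhombus) : Prop :=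
  (∀ ρ ∈ T, ∀ t ∈ ρ.triangles, InRegion n t) ∧
  ∀ t, InRegion n t → ∃! ρ, ρ ∈ T ∧ t ∈ ρ.triangles

/-- The (clockwise) rotation by `120°` about the centre of the hexagon, i.e. the affine map with
linear part `v ↦ u ↦ -(u + v) ↦ v` which maps `(0, 2)`, `(0, 0)`, `(-2, 0)` to `(0, 0)`,
`(-2, 0)`, `(0, 2)`. -/
def rot (p : Pt) : Pt := (p.2 - p.1 - 2, -p.1)

/-- Invariance of a set of rhombi under the rotation by `120°`. -/
def IsCyclicallySymmetric (T : Finset Rhombus) : Prop :=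
  T.image (fun ρ => ρ.vertices.image rot) = T.image Rhombus.vertices

/-- Cyclically symmetric rhombus tilings of the hexagon with triangular hole. -/
def CSTiling (n : ℕ) : Type :=
  {T : Finset Rhombus // IsTiling n T ∧ IsCyclicallySymmetric T}

/-! ### The fundamental region and the lattice paths -/

/-- The fundamental region: the parallelogram with vertices `(0, n+1)`, `(n-1, n+1)`, `(n-1, 0)`,
`(0, 0)`.  Its left border `x = 0` runs from the top vertex of the hexagon vertically downwards
along one side of the hole, its bottom border `y = 0` from there to the vertex `(n-1, 0)` of the
hexagon. -/
def InFundamental (n : ℕ) (p : Pt) : Prop :=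
  0 ≤ p.1 ∧ p.1 ≤ (n : ℤ) - 1 ∧ 0 ≤ p.2 ∧ p.2 ≤ (n : ℤ) + 1

open Classical in
/-- The restriction of a tiling to the fundamental region: the rhombi which lie in it, together
with those which are cut in two by its borders. -/
noncomputable def restriction (n : ℕ) (T : Finset Rhombus) : Finset Rhombus :=
  T.filter fun ρ => ∃ t ∈ ρ.triangles, ∀ p ∈ t.vertices, InFundamental n p

/-- The steps of the lattice paths.  The lattice point `(x, y)` represents the midpoint of the
lattice edge from `(x, y)` to `(x+1, y+1)`, which points from south-west to north-east.  Each
horizontal and each rising rhombus connects the midpoints of its two edges in this direction: a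
horizontal rhombus gives a unit step to the right, a rising one a unit step downwards. -/
def Step (S : Finset Rhombus) (a b : Pt) : Prop :=
  (b = a + (1, 0) ∧ (⟨.horizontal, a⟩ : Rhombus) ∈ S) ∨
  (b = a - (0, 1) ∧ (⟨.rising, a⟩ : Rhombus) ∈ S)

/-- `P` starts with the rhombus `⟨.horizontal, (-1, h)⟩`, which is cut in two by the left border
of the fundamental region. -/
def StartsAt (n : ℕ) (T : Finset Rhombus) (P : List Pt) (h : ℤ) : Prop :=
  P.head? = some (0, h) ∧ (⟨.horizontal, (-1, h)⟩ : Rhombus) ∈ restriction n T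

/-- `P` ends in the rhombus `⟨.rising, (x, 0)⟩`, which is cut in two by the bottom border of the
fundamental region. -/
def EndsAt (n : ℕ) (T : Finset Rhombus) (P : List Pt) (x : ℤ) : Prop :=
  P.getLast? = some (x, 0) ∧ (⟨.rising, (x, 0)⟩ : Rhombus) ∈ restriction n T

/-- The sequence of lattice points `P` is a path of the tiling `T` which connects a rhombus cut by
the left border of the fundamental region with a rhombus cut by the bottom border. -/
def IsPathOf (n : ℕ) (T : Finset Rhombus) (P : List Pt) : Prop :=
  P.IsChain (Step (restriction n T)) ∧ (∃ h, StartsAt n T P h) ∧ ∃ x, EndsAt n T P x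

/-- The height of the starting point of a path. -/
def startHeight (P : List Pt) : ℤ := (P.headD (0, 0)).2

/-- `F` lists all the paths of `T`, in the order of decreasing starting heights. -/
def IsPathFamily (n : ℕ) (T : Finset Rhombus) (F : List (List Pt)) : Prop :=
  (∀ P, P ∈ F ↔ IsPathOf n T P) ∧ F.Pairwise fun P Q => startHeight Q < startHeight P

/-- No two of the paths have a point in common. -/
def NonIntersecting (F : List (List Pt)) : Prop :=
  F.Pairwise fun P Q => ∀ a, a ∈ P → a ∉ Q

/-- The heights of the horizontal steps of a path, in the order in which they are traversed. -/
def stepHeights : List Pt → List ℤ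
  | a :: b :: P => if b.2 = a.2 then a.2 :: stepHeights (b :: P) else stepHeights (b :: P)
  | _ => []

/-- The row contributed by a path: the height of its starting point followed by the heights of its
horizontal steps, where steps at height `0` are not recorded. -/
def readRow (P : List Pt) : List ℤ :=
  (startHeight P :: stepHeights P).filter fun a => decide (0 < a)

/-! ### Counting horizontal rhombi -/

open Classical in
/-- The number of horizontal rhombi in the upper-most strip `n ≤ y ≤ n+1` of the fundamental
region (including one that is cut by its left border). -/
noncomputable def topStripCount (n : ℕ) (T : Finset Rhombus) : ℕ :=
  ((restriction n T).filter fun ρ =>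
    ρ.orientation = .horizontal ∧ ∀ p ∈ ρ.vertices, (n : ℤ) ≤ p.2).card

open Classical in
/-- The number of horizontal rhombi in the wedge which is cut off by the two rays that emanate from
the midpoint `(0, 1)` of the vertical side of the hole in the directions `u` and `u + v`. -/
noncomputable def wedgeCount (T : Finset Rhombus) : ℕ :=
  (T.filter fun ρ =>
    ρ.orientation = .horizontal ∧ ∀ p ∈ ρ.vertices, 1 ≤ p.2 ∧ p.2 ≤ p.1 + 1).card

open Classical in
/-- The number of horizontal rhombi in the fundamental region, including those cut by its left
border, and not counting those which have a side on its bottom border `y = 0`. -/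
noncomputable def regionCount (n : ℕ) (T : Finset Rhombus) : ℕ :=
  ((restriction n T).filter fun ρ =>
    ρ.orientation = .horizontal ∧ ∀ p ∈ ρ.vertices, 1 ≤ p.2).card

end DescendingPP

open DescendingPP

/-! The region is the union of three rotated copies of the fundamental parallelogram, so a
cyclically symmetric tiling amounts to a choice of orientation for the rhombus over `left p`, for
each cell `p`. The choice extends to a tiling exactly when every triangle `right p` is covered once
and no horizontal rhombus sticks out at the right border; this is `IsConfig`. The symmetry enters
only through `IsCyclicallySymmetric.left_border`: the rhombus cut by the left border at height `h`
rotates to the one cut by the bottom border at `x = h - 2`.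

A path is recorded by the heights at which it enters the successive columns. In column `t` it
occupies the vertical interval from `rowHeight r (t + 1)` to `rowHeight r t`, and `Above` says that
one interval lies strictly over the other. Applied in the columns with positive entries this is
strict decrease along columns; applied in the last column of the lower path it bounds the first
entry of a row by the length of the preceding row (`IsRow.above_iff`). The first entry of a row
exceeds its length because the path from height `h` has `h - 2` horizontal steps.

The point that is not local is that the path starting at height `h` does end at `x = h - 2`. By the
gluing, endpoints shifted by `2` are again starting heights, and by disjointness this map is
strictly increasing; a strictly increasing self-map of a finite chain is the identity
(`IsConfig.level_eq_zero_iff`). Hence configurations and families of rows correspond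
(`IsRows.isConfig`, `IsConfig.exists_isRows`).

The entry `a` at position `t` of a row is the horizontal rhombus with corner `(t - 1, a)`, so each
statistic counts the rhombi whose corner satisfies a linear condition. -/

namespace DescendingPP

/-! ### Rotation of triangles and rhombi -/

/-- The effect of the rotation by `120°` on the orientation of a rhombus. -/
def Orientation.next : Orientation → Orientation
  | .horizontal => .rising
  | .rising => .falling
  | .falling => .horizontal

/-- The rotation maps `Triangle.left p` to `Triangle.left (rotL p)`. -/
def rotL (p : Pt) : Pt := (p.2 - p.1 - 3, -p.1 - 1)

/-- The rotation maps `Triangle.right p` to `Triangle.right (rotR p)`. -/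
def rotR (p : Pt) : Pt := (p.2 - p.1 - 2, -p.1 - 1)

/-- The action of the rotation on unit triangles. -/
def Triangle.rotate : Triangle → Triangle
  | .left p => .left (rotL p)
  | .right p => .right (rotR p)

/-- The action of the rotation on rhombi. -/
def Rhombus.rotate (ρ : Rhombus) : Rhombus := ⟨ρ.orientation.next, rotL ρ.corner⟩

theorem Rhombus.rotate_rotate_rotate (ρ : Rhombus) : ρ.rotate.rotate.rotate = ρ := by
  obtain ⟨o, x, y⟩ := ρ
  cases o <;> simp [Rhombus.rotate, Orientation.next, rotL] <;> omega

theorem Triangle.rotate_rotate_rotate (t : Triangle) : t.rotate.rotate.rotate = t := by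
  obtain ⟨x, y⟩ | ⟨x, y⟩ := t <;> simp [Triangle.rotate, rotL, rotR] <;> omega

theorem Rhombus.rotate_injective : Function.Injective Rhombus.rotate :=
  fun a b h => by rw [← a.rotate_rotate_rotate, h, b.rotate_rotate_rotate]

theorem Triangle.rotate_injective : Function.Injective Triangle.rotate :=
  fun a b h => by rw [← a.rotate_rotate_rotate, h, b.rotate_rotate_rotate]

theorem Rhombus.triangles_rotate (ρ : Rhombus) :
    ρ.rotate.triangles = ρ.triangles.image Triangle.rotate := by
  obtain ⟨o, x, y⟩ := ρ
  cases o <;>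
    simp [Rhombus.rotate, Orientation.next, Rhombus.triangles, Triangle.rotate, rotL, rotR,
      Finset.image_insert] <;> congr 1 <;> ext t <;> simp <;> ring_nf

theorem Rhombus.rotate_mem_triangles (ρ : Rhombus) (t : Triangle) :
    t.rotate ∈ ρ.rotate.triangles ↔ t ∈ ρ.triangles := by
  rw [triangles_rotate, Finset.mem_image]
  exact ⟨fun ⟨a, ha, e⟩ => Triangle.rotate_injective e ▸ ha, fun h => ⟨t, h, rfl⟩⟩

theorem Triangle.vertices_rotate (t : Triangle) :
    t.rotate.vertices = t.vertices.image rot := by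
  obtain ⟨x, y⟩ | ⟨x, y⟩ := t <;> ext ⟨a, b⟩ <;>
    simp [Triangle.rotate, Triangle.vertices, rotL, rotR, rot] <;> omega

theorem Rhombus.vertices_rotate (ρ : Rhombus) :
    ρ.rotate.vertices = ρ.vertices.image rot := by
  simp only [Rhombus.vertices, triangles_rotate, Finset.image_biUnion, Finset.biUnion_image,
    Triangle.vertices_rotate]

theorem mem_vertices_horizontal (p q : Pt) : q ∈ (⟨.horizontal, p⟩ : Rhombus).vertices ↔
    q = p ∨ q = p + (1, 0) ∨ q = p + (1, 1) ∨ q = p + (2, 1) := by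
  obtain ⟨x, y⟩ := p
  obtain ⟨a, b⟩ := q
  simp [Rhombus.vertices, Rhombus.triangles, Triangle.vertices]
  omega

/-- The offsets `(4, 2)`, `(2, 0)`, `(2, 2)` are pairwise incongruent modulo `4`, so the vertex sum
determines both orientation and corner. This lets the symmetry, stated for vertex sets, be read as a
statement about rhombi. -/
theorem Rhombus.sum_vertices (ρ : Rhombus) : ∑ p ∈ ρ.vertices, p =
    (4 * ρ.corner.1, 4 * ρ.corner.2) + match ρ.orientation with
      | .horizontal => (4, 2)
      | .rising => (2, 0)
      | .falling => (2, 2) := by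
  obtain ⟨o, x, y⟩ := ρ
  cases o
  · have : (⟨.horizontal, (x, y)⟩ : Rhombus).vertices =
        {(x, y), (x + 1, y), (x + 1, y + 1), (x + 2, y + 1)} := by
      ext ⟨a, b⟩
      simp [Rhombus.vertices, Rhombus.triangles, Triangle.vertices]; omega
    rw [this]
    simp; omega
  · have : (⟨.rising, (x, y)⟩ : Rhombus).vertices =
        {(x, y - 1), (x, y), (x + 1, y), (x + 1, y + 1)} := by
      ext ⟨a, b⟩
      simp [Rhombus.vertices, Rhombus.triangles, Triangle.vertices]; omega
    rw [this]
    simp; omega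
  · have : (⟨.falling, (x, y)⟩ : Rhombus).vertices =
        {(x, y), (x + 1, y), (x + 1, y + 1), (x, y + 1)} := by
      ext ⟨a, b⟩
      simp [Rhombus.vertices, Rhombus.triangles, Triangle.vertices]; omega
    rw [this]
    simp; omega

theorem Rhombus.vertices_injective : Function.Injective Rhombus.vertices := by
  intro a b h
  have h2 := a.sum_vertices
  rw [h, b.sum_vertices] at h2
  obtain ⟨o, x, y⟩ := a
  obtain ⟨o', x', y'⟩ := b
  cases o <;> cases o' <;> simp at h2 ⊢ <;> omega

theorem isCyclicallySymmetric_iff (T : Finset Rhombus) :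
    IsCyclicallySymmetric T ↔ ∀ ρ, ρ.rotate ∈ T ↔ ρ ∈ T := by
  have h1 : IsCyclicallySymmetric T ↔ T.image Rhombus.rotate = T := by
    rw [IsCyclicallySymmetric,
      show (fun ρ : Rhombus => ρ.vertices.image rot) = Rhombus.vertices ∘ Rhombus.rotate from
        funext fun ρ => (ρ.vertices_rotate).symm,
      ← Finset.image_image]
    exact (Finset.image_injective Rhombus.vertices_injective).eq_iff
  rw [h1]
  constructor
  · intro h ρ
    conv_lhs => rw [← h]
    exact Rhombus.rotate_injective.mem_finset_image
  · intro h
    ext ρ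
    rw [Finset.mem_image]
    constructor
    · rintro ⟨a, ha, rfl⟩
      exact (h a).2 ha
    · intro hρ
      refine ⟨ρ.rotate.rotate, ?_, ρ.rotate_rotate_rotate⟩
      rwa [h, h]

theorem left_mem_triangles (ρ : Rhombus) (p : Pt) : .left p ∈ ρ.triangles ↔ ρ.corner = p := by
  obtain ⟨o, q⟩ := ρ
  cases o <;> simp [Rhombus.triangles, eq_comm]

theorem right_mem_triangles (ρ : Rhombus) (p : Pt) : .right p ∈ ρ.triangles ↔
    ρ = ⟨.falling, p⟩ ∨ ρ = ⟨.horizontal, p - (1, 0)⟩ ∨ ρ = ⟨.rising, p + (0, 1)⟩ := by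
  obtain ⟨o, x, y⟩ := ρ
  obtain ⟨a, b⟩ := p
  cases o <;> simp [Rhombus.triangles] <;> omega

/-! ### The region -/

theorem inRegion_left (n : ℕ) (x y : ℤ) : InRegion n (.left (x, y)) ↔
    (-((n : ℤ) + 1) ≤ x ∧ x + 1 ≤ n - 1 ∧ -((n : ℤ) - 1) ≤ y ∧ y ≤ n ∧
      -((n : ℤ) + 1) ≤ x - y ∧ x + 1 - y ≤ n - 1) ∧ ¬(x ≤ -1 ∧ 0 ≤ y ∧ y ≤ x + 2) := by
  simp [InRegion, Triangle.vertices, InHexagon, InHole]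
  omega

theorem inRegion_right (n : ℕ) (x y : ℤ) : InRegion n (.right (x, y)) ↔
    (-((n : ℤ) + 1) ≤ x ∧ x + 1 ≤ n - 1 ∧ -((n : ℤ) - 1) ≤ y ∧ y ≤ n ∧
      -((n : ℤ) + 1) ≤ x - y - 1 ∧ x - y ≤ n - 1) ∧ ¬(x ≤ -1 ∧ 0 ≤ y ∧ y ≤ x + 1) := by
  simp [InRegion, Triangle.vertices, InHexagon, InHole]
  omega

theorem inRegion_rotate (n : ℕ) (t : Triangle) : InRegion n t.rotate ↔ InRegion n t := by
  obtain ⟨x, y⟩ | ⟨x, y⟩ := t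
  · simp only [Triangle.rotate, rotL, inRegion_left]; omega
  · simp only [Triangle.rotate, rotR, inRegion_right]; omega

/-- The unit cells of the fundamental region: the cell `(x, y)` consists of the triangles
`left (x, y)` and `right (x, y)`. -/
def Cell (n : ℕ) (p : Pt) : Prop := 0 ≤ p.1 ∧ p.1 ≤ (n : ℤ) - 2 ∧ 0 ≤ p.2 ∧ p.2 ≤ (n : ℤ)

theorem Cell.left {n : ℕ} {p : Pt} (h : Cell n p) : InRegion n (.left p) := by
  obtain ⟨x, y⟩ := p
  simp only [Cell] at h
  rw [inRegion_left]; omega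

theorem Cell.right {n : ℕ} {p : Pt} (h : Cell n p) : InRegion n (.right p) := by
  obtain ⟨x, y⟩ := p
  simp only [Cell] at h
  rw [inRegion_right]; omega

/-- The three rotated copies of the fundamental parallelogram cover the region, which reduces
questions about symmetric tilings to cells. -/
theorem cell_of_inRegion_left {n : ℕ} {p : Pt} (h : InRegion n (.left p)) :
    Cell n p ∨ Cell n (rotL p) ∨ Cell n (rotL (rotL p)) := by
  obtain ⟨x, y⟩ := p
  rw [inRegion_left] at h
  simp only [Cell, rotL]; omega

theorem cell_of_inRegion_right {n : ℕ} {p : Pt} (h : InRegion n (.right p)) :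
    Cell n p ∨ Cell n (rotR p) ∨ Cell n (rotR (rotR p)) := by
  obtain ⟨x, y⟩ := p
  rw [inRegion_right] at h
  simp only [Cell, rotR]; omega

theorem inFundamental_left (n : ℕ) (p : Pt) :
    (∀ q ∈ (Triangle.left p).vertices, InFundamental n q) ↔ Cell n p := by
  obtain ⟨x, y⟩ := p
  simp [Triangle.vertices, InFundamental, Cell]; omega

theorem inFundamental_right (n : ℕ) (p : Pt) :
    (∀ q ∈ (Triangle.right p).vertices, InFundamental n q) ↔ Cell n p := by
  obtain ⟨x, y⟩ := p
  simp [Triangle.vertices, InFundamental, Cell]; omega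

/-! ### Cyclically symmetric tilings as local configurations -/

/-- If `m p` is the orientation of the rhombus covering `left p`, then `right p` is covered by a
horizontal rhombus, or by the rotated copy of such a rhombus. -/
def FromLeft (m : Pt → Orientation) (p : Pt) : Prop :=
  (0 < p.1 ∧ m (p - (1, 0)) = .horizontal) ∨ (p.1 = 0 ∧ 2 ≤ p.2 ∧ m (p.2 - 2, 0) = .rising)

/-- If `m p` is the orientation of the rhombus covering `left p`, then `right p` is covered by a
rising rhombus. -/
def FromAbove (n : ℕ) (m : Pt → Orientation) (p : Pt) : Prop :=
  p.2 < n ∧ m (p + (0, 1)) = .rising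

/-- The conditions under which orientations for the cells of the fundamental region describe a
cyclically symmetric tiling. -/
structure IsConfig (n : ℕ) (m : Pt → Orientation) : Prop where
  right_border : ∀ p, Cell n p → m p = .horizontal → p.1 + 1 ≤ (n : ℤ) - 2
  covered : ∀ p, Cell n p → m p = .falling ∨ FromLeft m p ∨ FromAbove n m p
  not_falling_left : ∀ p, Cell n p → m p = .falling → ¬ FromLeft m p
  not_falling_above : ∀ p, Cell n p → m p = .falling → ¬ FromAbove n m p
  not_left_above : ∀ p, Cell n p → FromLeft m p → ¬ FromAbove n m p

/-- The tiling `T` has the orientations `m` in the fundamental region. -/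
def Represents (n : ℕ) (m : Pt → Orientation) (T : Finset Rhombus) : Prop :=
  ∀ p, Cell n p → ∀ o, (⟨o, p⟩ : Rhombus) ∈ T ↔ m p = o

section
variable {n : ℕ} {T : Finset Rhombus}

theorem IsTiling.unique (hT : IsTiling n T) {ρ ρ' : Rhombus} {t : Triangle} (h : ρ ∈ T)
    (h' : ρ' ∈ T) (ht : t ∈ ρ.triangles) (ht' : t ∈ ρ'.triangles) : ρ = ρ' :=
  (hT.2 t (hT.1 ρ h t ht)).unique ⟨h, ht⟩ ⟨h', ht'⟩

theorem IsTiling.orientation_unique (hT : IsTiling n T) {o o' : Orientation} {p : Pt}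
    (h : (⟨o, p⟩ : Rhombus) ∈ T) (h' : (⟨o', p⟩ : Rhombus) ∈ T) : o = o' := by
  have := hT.unique h h' ((left_mem_triangles _ p).2 rfl) ((left_mem_triangles _ p).2 rfl)
  simpa using this

theorem IsTiling.exists_orientation (hT : IsTiling n T) {p : Pt} (h : InRegion n (.left p)) :
    ∃ o, (⟨o, p⟩ : Rhombus) ∈ T := by
  obtain ⟨⟨o, q⟩, ⟨h1, h2⟩, -⟩ := hT.2 _ h
  rw [left_mem_triangles] at h2
  obtain rfl : q = p := h2
  exact ⟨o, h1⟩

theorem IsTiling.horizontal_region (hT : IsTiling n T) {p : Pt}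
    (h : (⟨.horizontal, p⟩ : Rhombus) ∈ T) :
    InRegion n (.left p) ∧ InRegion n (.right (p + (1, 0))) :=
  ⟨hT.1 _ h _ (by simp [Rhombus.triangles]), hT.1 _ h _ (by simp [Rhombus.triangles])⟩

theorem IsTiling.rising_region (hT : IsTiling n T) {p : Pt}
    (h : (⟨.rising, p⟩ : Rhombus) ∈ T) :
    InRegion n (.left p) ∧ InRegion n (.right (p - (0, 1))) :=
  ⟨hT.1 _ h _ (by simp [Rhombus.triangles]), hT.1 _ h _ (by simp [Rhombus.triangles])⟩

/-- The rotation glues the left border to the bottom border with a shift by the side length `2` of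
the hole. -/
theorem IsCyclicallySymmetric.left_border (hC : IsCyclicallySymmetric T) (h : ℤ) :
    (⟨.horizontal, (-1, h)⟩ : Rhombus) ∈ T ↔ (⟨.rising, (h - 2, 0)⟩ : Rhombus) ∈ T := by
  rw [← (isCyclicallySymmetric_iff T).1 hC]
  simp only [Rhombus.rotate, rotL, Orientation.next]
  rw [show h - -1 - 3 = h - 2 by ring]
  rfl

theorem exists_represents (hT : IsTiling n T) : ∃ m, Represents n m T := by
  have : ∀ p, ∃ o, Cell n p → (⟨o, p⟩ : Rhombus) ∈ T := by
    intro p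
    by_cases hp : Cell n p
    · obtain ⟨o, ho⟩ := hT.exists_orientation hp.left
      exact ⟨o, fun _ => ho⟩
    · exact ⟨.falling, fun h => absurd h hp⟩
  choose m hm using this
  refine ⟨m, fun p hp o => ⟨fun h => hT.orientation_unique (hm p hp) h, ?_⟩⟩
  rintro rfl
  exact hm p hp

theorem Represents.fromLeft_iff {m : Pt → Orientation} (hm : Represents n m T)
    (hT : IsTiling n T) (hC : IsCyclicallySymmetric T) {p : Pt} (hp : Cell n p) :
    FromLeft m p ↔ (⟨.horizontal, p - (1, 0)⟩ : Rhombus) ∈ T := by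
  obtain ⟨x, y⟩ := p
  have hp' := hp
  simp only [Cell] at hp'
  rcases eq_or_lt_of_le hp'.1 with h | h
  · subst h
    have e : ((0, y) - (1, 0) : Pt) = (-1, y) := by simp
    simp only [FromLeft, e, hC.left_border, lt_irrefl, false_and, false_or, true_and]
    constructor
    · rintro ⟨h1, h2⟩
      exact (hm (y - 2, 0) (by simp only [Cell]; omega) _).2 h2
    · intro h1
      have h2 := (hT.rising_region h1).2
      -- For `y = 0, 1` the triangle `left (-1, y)` lies in the hole; this gives the bound `2 ≤ y`
      -- in `FromLeft`.
      have h3 := (hT.horizontal_region ((hC.left_border y).2 h1)).1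
      simp only [Prod.mk_sub_mk, inRegion_right] at h2
      rw [inRegion_left] at h3
      refine ⟨by omega, (hm (y - 2, 0) (by simp only [Cell]; omega) _).1 h1⟩
  · simp only [FromLeft, h, true_and, h.ne', false_and, or_false, Prod.mk_sub_mk]
    exact (hm (x - 1, y - 0) (by simp only [Cell]; omega) _).symm

theorem Represents.fromAbove_iff {m : Pt → Orientation} (hm : Represents n m T)
    (hT : IsTiling n T) {p : Pt} (hp : Cell n p) :
    FromAbove n m p ↔ (⟨.rising, p + (0, 1)⟩ : Rhombus) ∈ T := by
  obtain ⟨x, y⟩ := p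
  have hp' := hp
  simp only [Cell] at hp'
  simp only [FromAbove, Prod.mk_add_mk]
  constructor
  · rintro ⟨h1, h2⟩
    exact (hm (x + 0, y + 1) (by simp only [Cell]; omega) _).2 h2
  · intro h1
    have := (hT.rising_region h1).1
    simp only [inRegion_left] at this
    exact ⟨by omega, (hm (x + 0, y + 1) (by simp only [Cell]; omega) _).1 h1⟩

theorem Represents.isConfig {m : Pt → Orientation} (hm : Represents n m T)
    (hT : IsTiling n T) (hC : IsCyclicallySymmetric T) : IsConfig n m where
  right_border p hp h := by
    have := (hT.horizontal_region ((hm p hp _).2 h)).2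
    obtain ⟨x, y⟩ := p
    simp only [Prod.mk_add_mk, inRegion_right] at this
    simp only
    omega
  covered p hp := by
    obtain ⟨ρ, ⟨h1, h2⟩, -⟩ := hT.2 _ hp.right
    rw [hm.fromLeft_iff hT hC hp, hm.fromAbove_iff hT hp, ← hm p hp]
    rcases (right_mem_triangles _ _).1 h2 with rfl | rfl | rfl
    · exact .inl h1
    · exact .inr (.inl h1)
    · exact .inr (.inr h1)
  not_falling_left p hp h h' := by
    rw [hm.fromLeft_iff hT hC hp] at h'
    rw [← hm p hp] at h
    have := hT.unique (t := .right p) h h' (by simp [right_mem_triangles])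
      (by simp [right_mem_triangles])
    simp at this
  not_falling_above p hp h h' := by
    rw [hm.fromAbove_iff hT hp] at h'
    rw [← hm p hp] at h
    have := hT.unique (t := .right p) h h' (by simp [right_mem_triangles])
      (by simp [right_mem_triangles])
    simp at this
  not_left_above p hp h h' := by
    rw [hm.fromAbove_iff hT hp] at h'
    rw [hm.fromLeft_iff hT hC hp] at h
    have := hT.unique (t := .right p) h h' (by simp [right_mem_triangles])
      (by simp [right_mem_triangles])
    simp at this

/-- Some rotated copy of each rhombus has its left triangle in a cell, where `m` decides membership.
-/
theorem Represents.tiling_subset {m : Pt → Orientation} {T' : Finset Rhombus}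
    (hm : Represents n m T) (hm' : Represents n m T') (hT : IsTiling n T)
    (hC : IsCyclicallySymmetric T) (hC' : IsCyclicallySymmetric T') : T ⊆ T' := by
  rintro ⟨o, p⟩ h
  rw [isCyclicallySymmetric_iff] at hC hC'
  rcases cell_of_inRegion_left (hT.1 _ h _ ((left_mem_triangles _ p).2 rfl)) with hp | hp | hp
  · exact (hm' p hp o).2 ((hm p hp o).1 h)
  · rw [← hC] at h
    rw [← hC']
    exact (hm' _ hp _).2 ((hm _ hp _).1 h)
  · rw [← hC, ← hC] at h
    rw [← hC', ← hC']
    exact (hm' _ hp _).2 ((hm _ hp _).1 h)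

theorem Represents.tiling_unique {m : Pt → Orientation} {T' : Finset Rhombus}
    (hm : Represents n m T) (hm' : Represents n m T') (hT : IsTiling n T) (hT' : IsTiling n T')
    (hC : IsCyclicallySymmetric T) (hC' : IsCyclicallySymmetric T') : T = T' :=
  (hm.tiling_subset hm' hT hC hC').antisymm (hm'.tiling_subset hm hT' hC' hC)

end

/-! ### The tiling with a given configuration -/

/-- The rhombi of a configuration, one for each cell of the fundamental region. -/
noncomputable def configTiles (n : ℕ) (m : Pt → Orientation) : Finset Rhombus :=
  (Finset.Icc (0, 0) ((n : ℤ) - 2, (n : ℤ))).image fun p => ⟨m p, p⟩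

/-- The rhombi of a configuration together with their images under the rotations by `120°` and
`240°`. -/
noncomputable def configTiling (n : ℕ) (m : Pt → Orientation) : Finset Rhombus :=
  configTiles n m ∪ (configTiles n m).image Rhombus.rotate ∪
    ((configTiles n m).image Rhombus.rotate).image Rhombus.rotate

theorem mem_configTiles (n : ℕ) (m : Pt → Orientation) (ρ : Rhombus) :
    ρ ∈ configTiles n m ↔ Cell n ρ.corner ∧ m ρ.corner = ρ.orientation := by
  obtain ⟨o, x, y⟩ := ρ
  simp only [configTiles, Finset.mem_image, Finset.mem_Icc, Prod.exists, Prod.mk_le_mk, Cell,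
    Rhombus.mk.injEq, Prod.mk.injEq]
  constructor
  · rintro ⟨a, b, h, h1, rfl, rfl⟩
    exact ⟨by omega, h1⟩
  · rintro ⟨h, h1⟩
    exact ⟨x, y, by omega, h1, rfl, rfl⟩

theorem mem_configTiling (n : ℕ) (m : Pt → Orientation) (ρ : Rhombus) :
    ρ ∈ configTiling n m ↔ ρ ∈ configTiles n m ∨ ρ.rotate ∈ configTiles n m ∨
      ρ.rotate.rotate ∈ configTiles n m := by
  have key : ∀ (A : Finset Rhombus) (ρ : Rhombus),
      ρ ∈ A.image Rhombus.rotate ↔ ρ.rotate.rotate ∈ A := by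
    intro A ρ
    rw [Finset.mem_image]
    exact ⟨by rintro ⟨a, ha, rfl⟩; rwa [Rhombus.rotate_rotate_rotate],
      fun h => ⟨_, h, Rhombus.rotate_rotate_rotate _⟩⟩
  simp only [configTiling, Finset.mem_union, key, Rhombus.rotate_rotate_rotate]
  tauto

theorem configTiling_rotate (n : ℕ) (m : Pt → Orientation) (ρ : Rhombus) :
    ρ.rotate ∈ configTiling n m ↔ ρ ∈ configTiling n m := by
  simp only [mem_configTiling, Rhombus.rotate_rotate_rotate]
  tauto

/-- The rotated copies do not interfere: if `(x, y)` is a cell, its image under `rotL` has a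
negative second coordinate and its image under the square of `rotL` a negative first one. -/
theorem configTiling_represents (n : ℕ) (m : Pt → Orientation) :
    Represents n m (configTiling n m) := by
  rintro ⟨x, y⟩ hp o
  rw [mem_configTiling]
  simp only [mem_configTiles, Rhombus.rotate, rotL]
  simp only [Cell] at hp ⊢
  constructor
  · rintro (h | h | h)
    · exact h.2
    · omega
    · omega
  · exact fun h => .inl ⟨hp, h⟩

theorem configTiling_horizontal_iff {n : ℕ} {m : Pt → Orientation} {p : Pt} (hp : Cell n p) :
    (⟨.horizontal, p - (1, 0)⟩ : Rhombus) ∈ configTiling n m ↔ FromLeft m p := by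
  obtain ⟨x, y⟩ := p
  have hp' := hp
  simp only [Cell] at hp'
  rcases eq_or_lt_of_le hp'.1 with h | h
  · subst h
    rw [← configTiling_rotate]
    simp only [Rhombus.rotate, rotL, Orientation.next, Prod.mk_sub_mk, FromLeft, lt_irrefl,
      false_and, false_or, true_and]
    rw [show y - 0 - (0 - 1) - 3 = y - 2 by ring, show -(0 - 1 : ℤ) - 1 = 0 by ring]
    by_cases hy : 2 ≤ y
    · simp only [hy, true_and]
      exact configTiling_represents n m (y - 2, 0) (by simp only [Cell]; omega) _
    · simp only [hy, false_and, iff_false]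
      simp only [mem_configTiling, mem_configTiles, Rhombus.rotate, rotL, Cell]
      omega
  · simp only [FromLeft, h, true_and, h.ne', false_and, or_false, Prod.mk_sub_mk]
    exact configTiling_represents n m (x - 1, y - 0) (by simp only [Cell]; omega) _

theorem configTiling_rising_iff {n : ℕ} {m : Pt → Orientation} {p : Pt} (hp : Cell n p) :
    (⟨.rising, p + (0, 1)⟩ : Rhombus) ∈ configTiling n m ↔ FromAbove n m p := by
  obtain ⟨x, y⟩ := p
  have hp' := hp
  simp only [Cell] at hp'
  simp only [FromAbove, Prod.mk_add_mk]
  by_cases hy : y < n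
  · simp only [hy, true_and]
    exact configTiling_represents n m (x + 0, y + 1) (by simp only [Cell]; omega) _
  · simp only [hy, false_and, iff_false]
    simp only [mem_configTiling, mem_configTiles, Rhombus.rotate, rotL, Cell]
    omega

theorem existsUnique_rotate {T : Finset Rhombus} (hC : ∀ ρ : Rhombus, ρ.rotate ∈ T ↔ ρ ∈ T)
    (t : Triangle) (h : ∃! ρ, ρ ∈ T ∧ t.rotate ∈ ρ.triangles) :
    ∃! ρ, ρ ∈ T ∧ t ∈ ρ.triangles := by
  obtain ⟨ρ, ⟨h1, h2⟩, h3⟩ := h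
  have e := ρ.rotate_rotate_rotate
  refine ⟨ρ.rotate.rotate, ⟨by rwa [hC, hC], ?_⟩, ?_⟩
  · rw [← Rhombus.rotate_mem_triangles, e]; exact h2
  · rintro τ ⟨h4, h5⟩
    apply Rhombus.rotate_injective
    rw [e]
    exact h3 _ ⟨(hC _).2 h4, (Rhombus.rotate_mem_triangles _ _).2 h5⟩

theorem IsConfig.existsUnique_left {n : ℕ} {m : Pt → Orientation} {p : Pt}
    (hp : Cell n p) : ∃! ρ, ρ ∈ configTiling n m ∧ .left p ∈ ρ.triangles := by
  refine ⟨⟨m p, p⟩, ⟨(configTiling_represents n m p hp _).2 rfl, by simp [left_mem_triangles]⟩, ?_⟩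
  rintro ⟨o, q⟩ ⟨h1, h2⟩
  obtain rfl : q = p := (left_mem_triangles _ _).1 h2
  rw [(configTiling_represents n m q hp o).1 h1]

/-- Three rhombi can cover `right p`; the conditions of `IsConfig` say that exactly one of them is
present. -/
theorem IsConfig.existsUnique_right {n : ℕ} {m : Pt → Orientation} (hm : IsConfig n m) {p : Pt}
    (hp : Cell n p) : ∃! ρ, ρ ∈ configTiling n m ∧ .right p ∈ ρ.triangles := by
  have hF := configTiling_represents n m p hp .falling
  have hH := configTiling_horizontal_iff (m := m) hp
  have hV := configTiling_rising_iff (m := m) hp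
  have h1 := hm.not_falling_left p hp
  have h2 := hm.not_falling_above p hp
  have h3 := hm.not_left_above p hp
  rcases hm.covered p hp with h | h | h
  · refine ⟨_, ⟨hF.2 h, (right_mem_triangles _ _).2 (.inl rfl)⟩, ?_⟩
    rintro ρ ⟨h4, h5⟩
    rcases (right_mem_triangles _ _).1 h5 with rfl | rfl | rfl
    · rfl
    · exact absurd (hH.1 h4) (h1 h)
    · exact absurd (hV.1 h4) (h2 h)
  · refine ⟨_, ⟨hH.2 h, (right_mem_triangles _ _).2 (.inr (.inl rfl))⟩, ?_⟩
    rintro ρ ⟨h4, h5⟩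
    rcases (right_mem_triangles _ _).1 h5 with rfl | rfl | rfl
    · exact absurd h (h1 (hF.1 h4))
    · rfl
    · exact absurd (hV.1 h4) (h3 h)
  · refine ⟨_, ⟨hV.2 h, (right_mem_triangles _ _).2 (.inr (.inr rfl))⟩, ?_⟩
    rintro ρ ⟨h4, h5⟩
    rcases (right_mem_triangles _ _).1 h5 with rfl | rfl | rfl
    · exact absurd h (h2 (hF.1 h4))
    · exact absurd h (h3 (hH.1 h4))
    · rfl

theorem IsConfig.configTiles_region {n : ℕ} {m : Pt → Orientation} (hm : IsConfig n m)
    {ρ : Rhombus} (h : ρ ∈ configTiles n m) : ∀ t ∈ ρ.triangles, InRegion n t := by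
  obtain ⟨o, x, y⟩ := ρ
  obtain ⟨h1, h2⟩ := (mem_configTiles _ _ _).1 h
  have h3 := hm.right_border _ h1
  have h4 := h1.left
  have h5 := h1.right
  simp only [Cell] at h1 h2 h3
  cases o
  · simp only [Rhombus.triangles, Finset.mem_insert, Finset.mem_singleton, forall_eq_or_imp,
      forall_eq]
    refine ⟨h4, ?_⟩
    have := h3 h2
    simp only [Prod.mk_add_mk, inRegion_right]; omega
  · simp only [Rhombus.triangles, Finset.mem_insert, Finset.mem_singleton, forall_eq_or_imp,
      forall_eq]
    refine ⟨h4, ?_⟩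
    simp only [Prod.mk_sub_mk, inRegion_right]; omega
  · simp only [Rhombus.triangles, Finset.mem_insert, Finset.mem_singleton, forall_eq_or_imp,
      forall_eq]
    exact ⟨h4, h5⟩

theorem IsConfig.isTiling {n : ℕ} {m : Pt → Orientation} (hm : IsConfig n m) :
    IsTiling n (configTiling n m) := by
  have hC := configTiling_rotate n m
  constructor
  · intro ρ hρ t ht
    rcases (mem_configTiling _ _ _).1 hρ with h | h | h
    · exact hm.configTiles_region h t ht
    · rw [← inRegion_rotate]
      exact hm.configTiles_region h _ ((Rhombus.rotate_mem_triangles _ _).2 ht)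
    · rw [← inRegion_rotate, ← inRegion_rotate]
      exact hm.configTiles_region h _ ((Rhombus.rotate_mem_triangles _ _).2
        ((Rhombus.rotate_mem_triangles _ _).2 ht))
  · rintro (p | p) ht
    · rcases cell_of_inRegion_left ht with h | h | h
      · exact IsConfig.existsUnique_left h
      · exact existsUnique_rotate hC _ (IsConfig.existsUnique_left h)
      · exact existsUnique_rotate hC _ (existsUnique_rotate hC _ (IsConfig.existsUnique_left h))
    · rcases cell_of_inRegion_right ht with h | h | h
      · exact hm.existsUnique_right h
      · exact existsUnique_rotate hC _ (hm.existsUnique_right h)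
      · exact existsUnique_rotate hC _ (existsUnique_rotate hC _ (hm.existsUnique_right h))

theorem configTiling_isCyclicallySymmetric (n : ℕ) (m : Pt → Orientation) :
    IsCyclicallySymmetric (configTiling n m) :=
  (isCyclicallySymmetric_iff _).2 (configTiling_rotate n m)

/-! ### The rhombi of the fundamental region -/

open Classical in
theorem mem_restriction {n : ℕ} {T : Finset Rhombus} {ρ : Rhombus} : ρ ∈ restriction n T ↔
    ρ ∈ T ∧ ∃ t ∈ ρ.triangles, ∀ p ∈ t.vertices, InFundamental n p := by
  rw [restriction, Finset.mem_filter]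

/-- Horizontal rhombi are indexed by their right triangle, so that those cut by the left border are
included. None crosses the right border, which is also a border of the hexagon. -/
theorem Represents.horizontal_mem_restriction {n : ℕ} {m : Pt → Orientation} {T : Finset Rhombus}
    (hm : Represents n m T) (hT : IsTiling n T) (hC : IsCyclicallySymmetric T) (p : Pt) :
    (⟨.horizontal, p⟩ : Rhombus) ∈ restriction n T ↔
      Cell n (p + (1, 0)) ∧ FromLeft m (p + (1, 0)) := by
  rw [mem_restriction]
  simp only [Rhombus.triangles, Finset.mem_insert,
    Finset.mem_singleton, exists_eq_or_imp, exists_eq_left, inFundamental_left,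
    inFundamental_right]
  constructor
  · rintro ⟨h1, h2⟩
    have h3 : Cell n (p + (1, 0)) := by
      rcases h2 with h2 | h2
      · have h4 := hT.horizontal_region h1
        obtain ⟨x, y⟩ := p
        simp only [Prod.mk_add_mk, inRegion_right, Cell] at h2 h4 ⊢
        omega
      · exact h2
    refine ⟨h3, ?_⟩
    rwa [hm.fromLeft_iff hT hC h3, add_sub_cancel_right]
  · rintro ⟨h1, h2⟩
    rw [hm.fromLeft_iff hT hC h1, add_sub_cancel_right] at h2
    exact ⟨h2, .inr h1⟩

theorem Represents.rising_mem_restriction {n : ℕ} {m : Pt → Orientation} {T : Finset Rhombus}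
    (hm : Represents n m T) (hT : IsTiling n T) (p : Pt) :
    (⟨.rising, p⟩ : Rhombus) ∈ restriction n T ↔ Cell n p ∧ m p = .rising := by
  rw [mem_restriction]
  simp only [Rhombus.triangles, Finset.mem_insert,
    Finset.mem_singleton, exists_eq_or_imp, exists_eq_left, inFundamental_left,
    inFundamental_right]
  constructor
  · rintro ⟨h1, h2⟩
    have h3 : Cell n p := by
      rcases h2 with h2 | h2
      · exact h2
      · have h4 := hT.rising_region h1
        obtain ⟨x, y⟩ := p
        simp only [Prod.mk_sub_mk, inRegion_left, Cell] at h2 h4 ⊢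
        omega
    exact ⟨h3, (hm p h3 _).1 h1⟩
  · rintro ⟨h1, h2⟩
    exact ⟨(hm p h1 _).2 h2, .inl h1⟩

/-! ### Rows of descending plane partitions as height functions -/

/-- The height function of a row with first entry `h`: its value at `t` is the entry at position
`t`, with zeros appended to the row up to position `h - 2`, and `-1` from there on. The path of the
row enters the column `x = t` at height `rowHeight r t` and leaves it at height
`rowHeight r (t + 1)`, where `-1` means that the path leaves the column through the bottom border. -/
def rowHeight (r : List ℤ) (t : ℤ) : ℤ :=
  if t ≤ r.headD 0 - 2 then r.getD t.toNat 0 else -1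

/-- The conditions on a single row of a descending plane partition with entries at most `n`. -/
structure IsRow (n : ℕ) (r : List ℤ) : Prop where
  ne_nil : r ≠ []
  pos : ∀ a ∈ r, 0 < a
  anti : r.Pairwise fun a b => b ≤ a
  length_lt : (r.length : ℤ) < r.headD 0
  le : r.headD 0 ≤ n

/-- The path of `r` runs strictly above the path of `r'`. -/
def Above (r r' : List ℤ) : Prop :=
  ∀ t, 0 ≤ t → 0 ≤ rowHeight r' t → rowHeight r' t < rowHeight r (t + 1)

namespace IsRow
variable {n : ℕ} {r r' : List ℤ}

theorem length_pos (h : IsRow n r) : 0 < r.length := List.length_pos_iff.2 h.ne_nil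

theorem headD_eq (h : IsRow n r) : r.headD 0 = r[0]'h.length_pos := by
  cases r with
  | nil => exact absurd rfl h.ne_nil
  | cons a l => rfl

theorem two_le (h : IsRow n r) : 2 ≤ r.headD 0 := by
  have := h.length_pos
  have := h.length_lt
  omega

theorem rowHeight_of_lt (h : IsRow n r) {t : ℤ} (h0 : 0 ≤ t) (ht : t.toNat < r.length) :
    rowHeight r t = r[t.toNat] := by
  have := h.length_lt
  rw [rowHeight, if_pos (by omega), List.getD_eq_getElem _ _ ht]

theorem rowHeight_of_ge {t : ℤ} (ht : r.length ≤ t.toNat)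
    (ht' : t ≤ r.headD 0 - 2) : rowHeight r t = 0 := by
  rw [rowHeight, if_pos ht', List.getD_eq_default _ _ ht]

theorem rowHeight_of_gt {t : ℤ} (ht' : r.headD 0 - 1 ≤ t) : rowHeight r t = -1 := by
  rw [rowHeight, if_neg (by omega)]

theorem rowHeight_zero (h : IsRow n r) : rowHeight r 0 = r.headD 0 := by
  rw [h.rowHeight_of_lt le_rfl h.length_pos, h.headD_eq]; rfl

theorem rowHeight_cases (h : IsRow n r) {t : ℤ} (h0 : 0 ≤ t) :
    (∃ ht : t.toNat < r.length, rowHeight r t = r[t.toNat] ∧ 0 < rowHeight r t ∧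
      t ≤ r.headD 0 - 2) ∨
    (r.length ≤ t.toNat ∧ t ≤ r.headD 0 - 2 ∧ rowHeight r t = 0) ∨
    (r.headD 0 - 1 ≤ t ∧ r.length ≤ t.toNat ∧ rowHeight r t = -1) := by
  have h3 := h.length_lt
  by_cases h1 : t.toNat < r.length
  · have h2 := h.rowHeight_of_lt h0 h1
    exact .inl ⟨h1, h2, h2 ▸ h.pos _ (List.getElem_mem h1), by omega⟩
  · by_cases h2 : t ≤ r.headD 0 - 2
    · exact .inr (.inl ⟨by omega, h2, rowHeight_of_ge (by omega) h2⟩)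
    · exact .inr (.inr ⟨by omega, by omega, rowHeight_of_gt (by omega)⟩)

theorem rowHeight_nonneg_iff (h : IsRow n r) {t : ℤ} (h0 : 0 ≤ t) :
    0 ≤ rowHeight r t ↔ t ≤ r.headD 0 - 2 := by
  rcases h.rowHeight_cases h0 with ⟨_, h1, h2, h3⟩ | ⟨h1, h2, h3⟩ | ⟨h1, h2, h3⟩ <;> omega

theorem rowHeight_pos_iff (h : IsRow n r) {t : ℤ} (h0 : 0 ≤ t) :
    0 < rowHeight r t ↔ t.toNat < r.length := by
  rcases h.rowHeight_cases h0 with ⟨_, h1, h2, h3⟩ | ⟨h1, h2, h3⟩ | ⟨h1, h2, h3⟩ <;> omega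

theorem rowHeight_antitone (h : IsRow n r) {s t : ℤ} (hs : 0 ≤ s) (hst : s ≤ t) :
    rowHeight r t ≤ rowHeight r s := by
  rcases h.rowHeight_cases hs with ⟨h0, h1, h2, h3⟩ | ⟨h1, h2, h3⟩ | ⟨h1, h2, h3⟩ <;>
  rcases h.rowHeight_cases (hs.trans hst) with ⟨h0', h1', h2', h3'⟩ | ⟨h1', h2', h3'⟩ |
    ⟨h1', h2', h3'⟩ <;> try omega
  rw [h1, h1']
  rcases eq_or_lt_of_le hst with rfl | h4
  · rfl
  · exact List.pairwise_iff_getElem.1 h.anti _ _ h0 h0' (by omega)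

theorem rowHeight_le_headD (h : IsRow n r) {t : ℤ} (h0 : 0 ≤ t) : rowHeight r t ≤ r.headD 0 :=
  h.rowHeight_zero ▸ h.rowHeight_antitone le_rfl h0

/-- The length bound is `Above` in the last column `r'.headD 0 - 2` of the lower path, where the
upper path must still leave at positive height. Given this bound, only the columns with positive
entries of `r'` impose a further condition. -/
theorem above_iff (h : IsRow n r) (h' : IsRow n r') : Above r r' ↔
    r'.headD 0 ≤ r.length ∧
      ∀ (t : ℕ) (ht : t < r'.length) (ht1 : t + 1 < r.length), r'[t] < r[t + 1] := by
  have h2 := h'.two_le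
  constructor
  · intro H
    constructor
    · have h3 := H (r'.headD 0 - 2) (by omega) ((h'.rowHeight_nonneg_iff (by omega)).2 le_rfl)
      have h4 := (h'.rowHeight_nonneg_iff (t := r'.headD 0 - 2) (by omega)).2 le_rfl
      have h5 := (h.rowHeight_pos_iff (t := r'.headD 0 - 2 + 1) (by omega)).1 (by omega)
      omega
    · intro t ht ht1
      have h3 := H t (by omega) ((h'.rowHeight_pos_iff (t := t) (by omega)).2 (by simpa)).le
      rw [h'.rowHeight_of_lt (by omega) (by simpa), h.rowHeight_of_lt (by omega) (by omega)] at h3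
      exact h3
  · rintro ⟨h3, h4⟩ t h0 h5
    rw [h'.rowHeight_nonneg_iff h0] at h5
    have h6 : (t + 1).toNat < r.length := by omega
    have h7 := (h.rowHeight_pos_iff (t := t + 1) (by omega)).2 h6
    rcases h'.rowHeight_cases h0 with ⟨h8, h9, -⟩ | ⟨-, -, h8⟩ | ⟨h8, -⟩
    · rw [h9, h.rowHeight_of_lt (by omega) h6]
      have h10 : (t + 1).toNat = t.toNat + 1 := by omega
      simp only [h10]
      exact h4 _ h8 (by omega)
    · omega
    · omega

/-- Composing the two inequalities gains one column too many; monotonicity of the height of `r`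
absorbs it. -/
theorem above_trans (h : IsRow n r) {r'' : List ℤ} (h1 : Above r r')
    (h2 : Above r' r'') : Above r r'' := by
  intro t h0 h3
  have h4 := h2 t h0 h3
  have h5 := h1 (t + 1) (by omega) (by omega)
  have h6 := h.rowHeight_antitone (s := t + 1) (t := t + 1 + 1) (by omega) (by omega)
  omega

theorem above_headD (h : IsRow n r) (h' : IsRow n r') (H : Above r r') :
    r'.headD 0 < r.headD 0 := by
  have h1 := H 0 le_rfl (by rw [h'.rowHeight_zero]; have := h'.two_le; omega)
  have h2 := h.rowHeight_le_headD (t := 0 + 1) (by omega)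
  rw [h'.rowHeight_zero] at h1
  omega

end IsRow

/-- The rows `D` have the properties of the rows of a descending plane partition with entries at
most `n`, expressed in terms of the height functions. -/
structure IsRows (n : ℕ) (D : List (List ℤ)) : Prop where
  row : ∀ r ∈ D, IsRow n r
  above : D.Pairwise Above

theorem isRows_iff_isChain {n : ℕ} {D : List (List ℤ)} :
    IsRows n D ↔ (∀ r ∈ D, IsRow n r) ∧ D.IsChain Above := by
  refine ⟨fun h => ⟨h.1, h.2.isChain⟩, fun ⟨h1, h2⟩ => ⟨h1, ?_⟩⟩
  induction D with
  | nil => exact .nil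
  | cons r D ih =>
    have ih' := ih ⟨fun s hs => h1 s (.tail _ hs), h2.tail⟩ (fun s hs => h1 s (.tail _ hs))
      h2.tail
    refine List.pairwise_cons.2 ⟨?_, ih'⟩
    cases D with
    | nil => simp
    | cons s D =>
      have h3 := (List.isChain_cons_cons.1 h2).1
      intro q hq
      rcases List.mem_cons.1 hq with rfl | hq
      · exact h3
      · exact (h1 r (.head _)).above_trans h3 ((List.pairwise_cons.1 ih').1 q hq)

/-! ### Descending plane partitions as chains of rows -/

theorem IsDescending.ne_nil {D : List (List ℤ)} (h : IsDescending D) (i : ℕ) (hi : i < D.length) :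
    D.length ≤ i + D[i].length := by
  obtain ⟨k, hk⟩ : ∃ k, D.length = i + k + 1 := ⟨D.length - i - 1, by omega⟩
  induction k generalizing i with
  | zero => exact h.shape_last i hi (by omega)
  | succ k ih =>
    have h1 := h.shape i (by omega)
    have h2 := ih (i + 1) (by omega) (by omega)
    omega

theorem head?_eq_some_headD {r : List ℤ} (h : r ≠ []) : r.head? = some (r.headD 0) := by
  cases r with
  | nil => exact absurd rfl h
  | cons a l => rfl

theorem isDescending_iff_isRows {n : ℕ} {D : List (List ℤ)} :
    (IsDescending D ∧ ∀ row ∈ D, ∀ a ∈ row, a ≤ (n : ℤ)) ↔ IsRows n D := by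
  rw [isRows_iff_isChain, List.isChain_iff_getElem]
  constructor
  · rintro ⟨h, hn⟩
    have hne : ∀ r ∈ D, r ≠ [] := by
      intro r hr e
      obtain ⟨i, hi, rfl⟩ := List.getElem_of_mem hr
      have := h.ne_nil i hi
      rw [e, List.length_nil] at this
      omega
    have hrow : ∀ r ∈ D, IsRow n r := fun r hr =>
      { ne_nil := hne r hr
        pos := h.pos r hr
        anti := h.rows r hr
        length_lt := h.lt_first r hr _ (head?_eq_some_headD (hne r hr))
        le := hn r hr _ (List.mem_of_mem_head? (head?_eq_some_headD (hne r hr))) }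
    refine ⟨hrow, fun i hi => ?_⟩
    rw [(hrow _ (List.getElem_mem _)).above_iff (hrow _ (List.getElem_mem _))]
    exact ⟨h.first_le i hi _ (head?_eq_some_headD (hne _ (List.getElem_mem _))),
      fun t ht ht1 => h.cols i t hi ht ht1⟩
  · rintro ⟨hrow, hch⟩
    have key : ∀ (i : ℕ) (hi : i + 1 < D.length), _ := fun i hi =>
      ((hrow _ (List.getElem_mem _)).above_iff (hrow _ (List.getElem_mem _))).1 (hch i hi)
    refine ⟨⟨fun r hr => (hrow r hr).pos, ?_, ?_, fun r hr => (hrow r hr).anti,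
      fun i t h => (key i h).2 t, ?_, ?_⟩, ?_⟩
    · intro i hi
      have := (hrow _ (List.getElem_mem hi)).length_lt
      have := (key i hi).1
      omega
    · intro i hi h
      have := (hrow _ (List.getElem_mem hi)).length_pos
      omega
    · intro i hi a ha
      rw [head?_eq_some_headD (hrow _ (List.getElem_mem hi)).ne_nil] at ha
      obtain rfl := Option.some.inj ha
      exact (key i hi).1
    · intro r hr a ha
      rw [head?_eq_some_headD (hrow _ hr).ne_nil] at ha
      obtain rfl := Option.some.inj ha
      exact (hrow _ hr).length_lt
    · intro r hr a ha
      obtain ⟨i, hi, rfl⟩ := List.getElem_of_mem ha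
      have h := hrow r hr
      have h1 := h.rowHeight_le_headD (t := i) (by omega)
      rw [h.rowHeight_of_lt (t := i) (by omega) (by simpa)] at h1
      exact h1.trans h.le

/-! ### The configuration of a family of rows -/

/-- The path of some row leaves the lattice point `p` by a horizontal step. -/
def HasHorizontal (D : List (List ℤ)) (p : Pt) : Prop :=
  ∃ r ∈ D, rowHeight r (p.1 + 1) = p.2

/-- The path of some row leaves the lattice point `p` by a downward step. -/
def HasRising (D : List (List ℤ)) (p : Pt) : Prop :=
  ∃ r ∈ D, rowHeight r (p.1 + 1) < p.2 ∧ p.2 ≤ rowHeight r p.1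

open Classical in
/-- The orientations of the rhombi described by the rows `D`. -/
noncomputable def rowsConfig (D : List (List ℤ)) (p : Pt) : Orientation :=
  if HasHorizontal D p then .horizontal else if HasRising D p then .rising else .falling

namespace IsRows
variable {n : ℕ} {D : List (List ℤ)}

theorem eq_or_above (h : IsRows n D) {r r' : List ℤ} (hr : r ∈ D) (hr' : r' ∈ D) :
    r = r' ∨ Above r r' ∨ Above r' r := by
  have : Std.Symm fun r r' => r = r' ∨ Above r r' ∨ Above r' r := by
    constructor
    rintro a b (rfl | h | h)
    exacts [.inl rfl, .inr (.inr h), .inr (.inl h)]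
  exact List.Pairwise.forall_of_forall (R := fun r r' => r = r' ∨ Above r r' ∨ Above r' r)
    (fun _ _ => .inl rfl) (h.above.imp fun h => .inr (.inl h)) hr hr'

/-- The intervals occupied by two different paths in a column are disjoint. -/
theorem row_unique (h : IsRows n D) {r r' : List ℤ} (hr : r ∈ D) (hr' : r' ∈ D) {x y : ℤ}
    (hx : 0 ≤ x) (hy : 0 ≤ y) (h1 : rowHeight r (x + 1) ≤ y) (h2 : y ≤ rowHeight r x)
    (h1' : rowHeight r' (x + 1) ≤ y) (h2' : y ≤ rowHeight r' x) : r = r' := by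
  rcases h.eq_or_above hr hr' with h3 | h3 | h3
  · exact h3
  · have := h3 x hx (by omega)
    omega
  · have := h3 x hx (by omega)
    omega

theorem rowsConfig_eq_horizontal {p : Pt} :
    rowsConfig D p = .horizontal ↔ HasHorizontal D p := by
  rw [rowsConfig]
  split_ifs <;> simp [*]

theorem rowsConfig_eq_rising (h : IsRows n D) {p : Pt} (hp : Cell n p) :
    rowsConfig D p = .rising ↔ HasRising D p := by
  rw [rowsConfig]
  split_ifs with h1 h2
  · simp only [false_iff]
    rintro ⟨r, hr, h3, h4⟩
    obtain ⟨r', hr', h5⟩ := h1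
    obtain ⟨hx, -, hy, -⟩ := hp
    have h6 := (h.row _ hr').rowHeight_antitone hx (show p.1 ≤ p.1 + 1 by omega)
    obtain rfl := h.row_unique hr hr' hx hy (by omega) (by omega) (by omega) (by omega)
    omega
  · simp [h2]
  · simp [h2]

theorem rowsConfig_eq_falling {p : Pt} :
    rowsConfig D p = .falling ↔ ¬ HasHorizontal D p ∧ ¬ HasRising D p := by
  rw [rowsConfig]
  split_ifs <;> simp [*]

/-- On the left border this is the gluing condition: a row leaves through the bottom of column `y -
2` exactly when its first entry, which is its height at `0`, equals `y`. -/
theorem fromLeft_iff (h : IsRows n D) {p : Pt} (hp : Cell n p) :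
    FromLeft (rowsConfig D) p ↔ ∃ r ∈ D, rowHeight r p.1 = p.2 := by
  obtain ⟨x, y⟩ := p
  have hp' := hp
  simp only [Cell] at hp'
  rcases eq_or_lt_of_le hp'.1 with h0 | h0
  · subst h0
    simp only [FromLeft, lt_irrefl, false_and, false_or, true_and]
    constructor
    · rintro ⟨h1, h2⟩
      rw [h.rowsConfig_eq_rising (by simp only [Cell]; omega)] at h2
      obtain ⟨r, hr, h3, h4⟩ := h2
      have hR := h.row r hr
      rw [hR.rowHeight_nonneg_iff (by simp only; omega)] at h4
      have h5 := hR.rowHeight_nonneg_iff (t := y - 2 + 1) (by omega)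
      refine ⟨r, hr, ?_⟩
      simp only at h3 h4
      rw [hR.rowHeight_zero]; omega
    · rintro ⟨r, hr, h1⟩
      have hR := h.row r hr
      rw [hR.rowHeight_zero] at h1
      have h2 := hR.two_le
      refine ⟨by omega, (h.rowsConfig_eq_rising (by simp only [Cell]; omega)).2 ⟨r, hr, ?_⟩⟩
      have h5 := hR.rowHeight_nonneg_iff (t := y - 2 + 1) (by omega)
      have h6 := hR.rowHeight_nonneg_iff (t := y - 2) (by omega)
      simp only
      omega
  · simp only [FromLeft, h0, true_and, h0.ne', false_and, or_false, rowsConfig_eq_horizontal,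
      HasHorizontal, Prod.fst_sub, Prod.snd_sub, sub_add_cancel, sub_zero]

theorem fromAbove_iff (h : IsRows n D) {p : Pt} (hp : Cell n p) :
    FromAbove n (rowsConfig D) p ↔
      ∃ r ∈ D, rowHeight r (p.1 + 1) ≤ p.2 ∧ p.2 < rowHeight r p.1 := by
  obtain ⟨x, y⟩ := p
  have hp' := hp
  simp only [Cell] at hp'
  simp only [FromAbove, Prod.mk_add_mk, add_zero]
  constructor
  · rintro ⟨h1, h2⟩
    rw [h.rowsConfig_eq_rising (by simp only [Cell]; omega)] at h2
    obtain ⟨r, hr, h3, h4⟩ := h2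
    simp only at h3 h4
    exact ⟨r, hr, by omega, by omega⟩
  · rintro ⟨r, hr, h1, h2⟩
    have h3 := (h.row r hr).rowHeight_le_headD hp'.1
    have h4 := (h.row r hr).le
    refine ⟨by omega, ?_⟩
    rw [h.rowsConfig_eq_rising (by simp only [Cell]; omega)]
    exact ⟨r, hr, by simp only; omega, by simp only; omega⟩

theorem isConfig (h : IsRows n D) : IsConfig n (rowsConfig D) where
  right_border p hp h1 := by
    rw [rowsConfig_eq_horizontal] at h1
    obtain ⟨r, hr, h2⟩ := h1
    obtain ⟨hx, -, hy, -⟩ := hp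
    have h3 := ((h.row r hr).rowHeight_nonneg_iff (t := p.1 + 1) (by omega)).1 (by omega)
    have h4 := (h.row r hr).le
    omega
  covered p hp := by
    rw [h.fromLeft_iff hp, h.fromAbove_iff hp, rowsConfig_eq_falling]
    by_contra! H
    obtain ⟨h1, h2, h3⟩ := H
    have h4 : HasRising D p := by
      by_contra h5
      apply h5
      apply h1
      rintro ⟨r, hr, h6⟩
      -- A path that leaves `p` must have entered it, from the left or from above.
      have h7 := (h.row r hr).rowHeight_antitone hp.1 (show p.1 ≤ p.1 + 1 by omega)
      have := h2 r hr
      have := h3 r hr (by omega)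
      omega
    obtain ⟨r, hr, h6⟩ := h4
    have := h2 r hr
    have := h3 r hr (by omega)
    omega
  not_falling_left p hp h1 h2 := by
    rw [h.fromLeft_iff hp] at h2
    rw [rowsConfig_eq_falling] at h1
    obtain ⟨r, hr, h3⟩ := h2
    have h4 := (h.row r hr).rowHeight_antitone hp.1 (show p.1 ≤ p.1 + 1 by omega)
    rcases eq_or_lt_of_le h4 with h5 | h5
    · exact h1.1 ⟨r, hr, by omega⟩
    · exact h1.2 ⟨r, hr, by omega, by omega⟩
  not_falling_above p hp h1 h2 := by
    rw [h.fromAbove_iff hp] at h2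
    rw [rowsConfig_eq_falling] at h1
    obtain ⟨r, hr, h3, h4⟩ := h2
    rcases eq_or_lt_of_le h3 with h5 | h5
    · exact h1.1 ⟨r, hr, by omega⟩
    · exact h1.2 ⟨r, hr, by omega, by omega⟩
  not_left_above p hp h1 h2 := by
    rw [h.fromAbove_iff hp] at h2
    rw [h.fromLeft_iff hp] at h1
    obtain ⟨r, hr, h3, h4⟩ := h2
    obtain ⟨r', hr', h5⟩ := h1
    have h6 := (h.row _ hr').rowHeight_antitone hp.1 (show p.1 ≤ p.1 + 1 by omega)
    obtain rfl := h.row_unique hr hr' hp.1 hp.2.2.1 h3 h4.le (by omega) (by omega)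
    omega

end IsRows

/-! ### The rows of a configuration -/

/-- Following rising rhombi downwards in the column `x`, starting at height `c - 1`, one leaves
the column at height `dropTo m x c - 1`; the value `0` means that one leaves it through the bottom
border. -/
def dropTo (m : Pt → Orientation) (x : ℕ) : ℕ → ℕ
  | 0 => 0
  | c + 1 => if m (x, c) = .rising then dropTo m x c else c + 1

theorem dropTo_le (m : Pt → Orientation) (x c : ℕ) : dropTo m x c ≤ c := by
  induction c with
  | zero => rfl
  | succ c ih =>
    rw [dropTo]
    split_ifs <;> omega

theorem eq_rising_of_dropTo_le {m : Pt → Orientation} {x c d : ℕ} (h : dropTo m x c ≤ d)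
    (hd : d < c) : m (x, d) = .rising := by
  induction c with
  | zero => omega
  | succ c ih =>
    rw [dropTo] at h
    split_ifs at h with h1
    · rcases eq_or_lt_of_le (Nat.le_of_lt_succ hd) with rfl | h2
      · exact h1
      · exact ih h h2
    · omega

theorem ne_rising_of_dropTo_eq {m : Pt → Orientation} {x c d : ℕ} (h : dropTo m x c = d + 1) :
    m (x, d) ≠ .rising := by
  induction c with
  | zero => simp [dropTo] at h
  | succ c ih =>
    rw [dropTo] at h
    split_ifs at h with h1
    · exact ih h
    · obtain rfl : c = d := by omega
      exact h1

/-- The path starting at height `h` enters the column `x = t` at height `level m h t - 1`; the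
value `0` means that it has left the fundamental region before. -/
def level (m : Pt → Orientation) (h : ℕ) : ℕ → ℕ
  | 0 => h + 1
  | t + 1 => dropTo m t (level m h t)

/-- A path starts at height `h`. -/
def IsStart (n : ℕ) (m : Pt → Orientation) (h : ℕ) : Prop :=
  2 ≤ h ∧ h ≤ n ∧ m ((h : ℤ) - 2, 0) = .rising

theorem level_succ_le (m : Pt → Orientation) (h t : ℕ) : level m h (t + 1) ≤ level m h t :=
  dropTo_le _ _ _

theorem level_antitone (m : Pt → Orientation) (h : ℕ) : Antitone (level m h) :=
  antitone_nat_of_succ_le (level_succ_le m h)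

namespace IsConfig
variable {n : ℕ} {m : Pt → Orientation}

/-- Where the descent stops, the path has arrived through `right (t, c)`, from the left if `c = b`
and from above otherwise. A falling rhombus would cover this triangle again, so only a horizontal
one remains. -/
theorem eq_horizontal_of_dropTo (hm : IsConfig n m) {t b c : ℕ} (hb : Cell n (t, b))
    (hl : FromLeft m (t, b)) (h : dropTo m t (b + 1) = c + 1) : m (t, c) = .horizontal := by
  have h1 := ne_rising_of_dropTo_eq h
  have h2 := dropTo_le m t (b + 1)
  have hc : Cell n (t, c) := by simp only [Cell] at hb ⊢; omega
  have h3 : m (t, c) ≠ .falling := by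
    intro h3
    rcases eq_or_lt_of_le (show c ≤ b by omega) with rfl | h4
    · exact hm.not_falling_left _ hc h3 hl
    · refine hm.not_falling_above _ hc h3 ⟨?_, ?_⟩
      · simp only [Cell] at hb ⊢; omega
      · have := eq_rising_of_dropTo_le (d := c + 1) h.le (by omega)
        simpa using this
  revert h1 h3
  cases m (t, c) <;> simp

theorem level_fromLeft (hm : IsConfig n m) {h : ℕ} (hs : IsStart n m h) {t c : ℕ}
    (hc : level m h t = c + 1) : Cell n (t, c) ∧ FromLeft m (t, c) := by
  induction t generalizing c with
  | zero =>
    obtain ⟨h1, h2, h3⟩ := hs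
    obtain rfl : h = c := by simpa [level] using hc
    exact ⟨by simp only [Cell]; omega, .inr ⟨rfl, by simpa using h1, h3⟩⟩
  | succ t ih =>
    have h1 := level_succ_le m h t
    obtain ⟨b, hb⟩ : ∃ b, level m h t = b + 1 := ⟨level m h t - 1, by omega⟩
    obtain ⟨h2, h3⟩ := ih hb
    rw [level, hb] at hc
    have h4 := hm.eq_horizontal_of_dropTo h2 h3 hc
    have h5 := dropTo_le m t (b + 1)
    have hcell : Cell n (t, c) := by simp only [Cell] at h2 ⊢; omega
    have h6 := hm.right_border _ hcell h4
    refine ⟨by simp only [Cell] at h2 h6 ⊢; omega, .inl ⟨by simp only; omega, ?_⟩⟩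
    simpa using h4

theorem level_horizontal (hm : IsConfig n m) {h : ℕ} (hs : IsStart n m h) {t c : ℕ}
    (hc : level m h (t + 1) = c + 1) : m (t, c) = .horizontal := by
  have h1 := level_succ_le m h t
  obtain ⟨b, hb⟩ : ∃ b, level m h t = b + 1 := ⟨level m h t - 1, by omega⟩
  obtain ⟨h2, h3⟩ := hm.level_fromLeft hs hb
  rw [level, hb] at hc
  exact hm.eq_horizontal_of_dropTo h2 h3 hc

/-- If the upper path came down to the point where the lower one enters the column, the right
triangle there would be covered both from the left and from above. -/
theorem level_lt_level_succ (hm : IsConfig n m) {h h' : ℕ} (hs : IsStart n m h)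
    (hs' : IsStart n m h') (hlt : h' < h) {t : ℕ} (ht : 0 < level m h' t) :
    level m h' t < level m h (t + 1) := by
  have key : ∀ t, 0 < level m h' t → level m h' t < level m h t →
      level m h' t < level m h (t + 1) := by
    intro t ht hl
    obtain ⟨c, hc⟩ : ∃ c, level m h' t = c + 1 := ⟨level m h' t - 1, by omega⟩
    obtain ⟨h2, h3⟩ := hm.level_fromLeft hs' hc
    by_contra! H
    have h4 : m (t, (c + 1 : ℕ)) = .rising :=
      eq_rising_of_dropTo_le (c := level m h t) (H.trans hc.le) (by omega)
    have h5 := level_antitone m h (Nat.zero_le t)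
    have h6 := hs.2.1
    rw [level] at h5
    refine hm.not_left_above _ h2 h3 ⟨by simp only; omega, ?_⟩
    simpa using h4
  refine key t ht ?_
  induction t with
  | zero => simpa [level] using hlt
  | succ t ih =>
    have h1 := level_succ_le m h' t
    exact h1.trans_lt (key t (by omega) (ih (by omega)))

theorem exists_last (hm : IsConfig n m) {h : ℕ} (hs : IsStart n m h) :
    ∃ t, 0 < level m h t ∧ level m h (t + 1) = 0 := by
  have hex : ∃ t, level m h t = 0 := by
    -- There is no cell with first coordinate `n`, so every path has ended by then.
    refine ⟨n, ?_⟩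
    by_contra H
    obtain ⟨c, hc⟩ : ∃ c, level m h n = c + 1 := ⟨level m h n - 1, by omega⟩
    have := (hm.level_fromLeft hs hc).1
    simp only [Cell] at this
    omega
  classical
  have h1 := Nat.find_spec hex
  obtain ⟨t, ht⟩ : ∃ t, Nat.find hex = t + 1 := by
    refine Nat.exists_eq_succ_of_ne_zero fun h0 => ?_
    rw [h0, level] at h1
    omega
  exact ⟨t, Nat.pos_of_ne_zero (Nat.find_min hex (by omega)), ht ▸ h1⟩

theorem isStart_of_last (hm : IsConfig n m) {h : ℕ} (hs : IsStart n m h) {t : ℕ}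
    (ht : 0 < level m h t) (ht1 : level m h (t + 1) = 0) : IsStart n m (t + 2) := by
  obtain ⟨c, hc⟩ : ∃ c, level m h t = c + 1 := ⟨level m h t - 1, by omega⟩
  have h1 := (hm.level_fromLeft hs hc).1
  simp only [Cell] at h1
  refine ⟨by omega, by omega, ?_⟩
  have h2 : m (t, (0 : ℕ)) = .rising := eq_rising_of_dropTo_le ht1.le ht
  simpa using h2

/-- A path that starts at height `h` ends in column `h - 2`: sending a start to its endpoint plus
`2` is a strictly increasing self-map of the finite chain of starting heights, hence the identity.
-/
theorem level_eq_zero_iff (hm : IsConfig n m) {h : ℕ} (hs : IsStart n m h) (t : ℕ) :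
    level m h t = 0 ↔ h ≤ t + 1 := by
  choose e he he' using fun s : {h // IsStart n m h} => hm.exists_last s.2
  let f : {h // IsStart n m h} → {h // IsStart n m h} := fun s =>
    ⟨e s + 2, hm.isStart_of_last s.2 (he s) (he' s)⟩
  have hf : StrictMono f := by
    intro s' s hlt
    have h1 := hm.level_lt_level_succ s.2 s'.2 hlt (he s')
    -- The upper path is still present one column after the lower one has ended, so it ends strictly
    -- later.
    have h2 : ¬ e s ≤ e s' := fun h3 => by
      have := level_antitone m s.1 (Nat.succ_le_succ h3)
      have := he' s
      simp only [Nat.succ_eq_add_one] at *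
      omega
    change e s' + 2 < e s + 2
    omega
  have hfin : Finite {h // IsStart n m h} :=
    Set.Finite.subset (Set.finite_Iic n) fun h hs => hs.2.1
  have h1 : f ⟨h, hs⟩ = ⟨h, hs⟩ := le_antisymm hf.apply_le hf.le_apply
  have h2 : e ⟨h, hs⟩ + 2 = h := congrArg Subtype.val h1
  constructor
  · intro h3
    by_contra h4
    have := level_antitone m h (show t ≤ e ⟨h, hs⟩ by omega)
    have := he ⟨h, hs⟩
    simp only at this
    omega
  · intro h3
    have := level_antitone m h (show e ⟨h, hs⟩ + 1 ≤ t by omega)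
    have := he' ⟨h, hs⟩
    simp only at this
    omega

/-- Every point entered by a step lies on a path from the left border: backward steps decrease `x +
(n - y)`, and each predecessor, not being falling, is itself entered unless the border is reached.
-/
theorem exists_level (hm : IsConfig n m) {x y : ℕ} (hp : Cell n (x, y))
    (h : FromLeft m (x, y) ∨ FromAbove n m (x, y)) :
    ∃ h, IsStart n m h ∧ level m h (x + 1) ≤ y + 1 ∧ y + 1 ≤ level m h x := by
  obtain ⟨k, hk⟩ : ∃ k, x + (n - y) = k := ⟨_, rfl⟩
  induction k using Nat.strong_induction_on generalizing x y with
  | _ k ih =>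
    have hp' := hp
    simp only [Cell] at hp'
    have key : ∀ (a b : ℕ), Cell n (a, b) → m (a, b) ≠ .falling →
        FromLeft m (a, b) ∨ FromAbove n m (a, b) := fun a b hab h3 =>
      (hm.covered _ hab).resolve_left h3
    rcases h with (⟨h1, h2⟩ | ⟨h1, h2, h3⟩) | ⟨h1, h2⟩
    · obtain ⟨x, rfl⟩ : ∃ x' : ℕ, x = x' + 1 := ⟨x - 1, by simp only at h1; omega⟩
      have h2' : m (x, y) = .horizontal := by simpa using h2
      have hc : Cell n (x, y) := by simp only [Cell]; omega
      obtain ⟨h, hs, h4, h5⟩ := ih _ (by omega) hc (key _ _ hc (by simp [h2'])) rfl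
      refine ⟨h, hs, (level_succ_le m h (x + 1)).trans h4, ?_⟩
      by_contra h6
      have := eq_rising_of_dropTo_le (m := m) (x := x) (c := level m h x) (d := y)
        (by rw [level] at h6; omega) (by omega)
      simp [h2'] at this
    · simp only at h1 h2 h3
      obtain rfl : x = 0 := by omega
      refine ⟨y, ⟨by omega, by omega, h3⟩, level_succ_le m y 0, le_rfl⟩
    · simp only [Prod.mk_add_mk, add_zero] at h1 h2
      have hc : Cell n (x, (y + 1 : ℕ)) := by simp only [Cell]; omega
      have h2' : m (x, (y + 1 : ℕ)) = .rising := by simpa using h2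
      obtain ⟨h, hs, h4, h5⟩ := ih _ (by omega) hc (key _ _ hc (by rw [h2']; simp)) rfl
      refine ⟨h, hs, ?_, by omega⟩
      by_contra h6
      exact ne_rising_of_dropTo_eq (show level m h (x + 1) = y + 1 + 1 by omega) h2'

theorem exists_row (hm : IsConfig n m) {h : ℕ} (hs : IsStart n m h) :
    ∃ r, IsRow n r ∧ ∀ t : ℕ, rowHeight r t = (level m h t : ℤ) - 1 := by
  have hex : ∃ t, level m h t ≤ 1 := ⟨h, by rw [(hm.level_eq_zero_iff hs h).2 (by omega)]; omega⟩
  -- Levels are heights plus one, so `l` counts the columns entered at positive height; it becomes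
  -- the length of the row.
  obtain ⟨l, hl⟩ : ∃ l, ∀ t, t < l ↔ 2 ≤ level m h t := by
    classical
    refine ⟨Nat.find hex, fun t => ⟨fun h1 => ?_, fun h1 => ?_⟩⟩
    · have := Nat.find_min hex h1
      omega
    · by_contra h2
      have := level_antitone m h (not_lt.1 h2)
      have := Nat.find_spec hex
      omega
  have ⟨h1, h2, _⟩ := hs
  have h0 : level m h 0 = h + 1 := rfl
  have hl0 : 0 < l := (hl 0).2 (by omega)
  -- The level at `h - 1` is already `0`; this makes the first entry exceed the length.
  have hlh : l < h := by
    by_contra h3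
    have := (hl (h - 1)).1 (by omega)
    have := (hm.level_eq_zero_iff hs (h - 1)).2 (by omega)
    omega
  obtain ⟨r, hr⟩ : ∃ r, r = (List.range l).map fun t => (level m h t : ℤ) - 1 := ⟨_, rfl⟩
  have hlen : r.length = l := by simp [hr]
  have hhead : r.headD 0 = h := by
    obtain ⟨k, rfl⟩ : ∃ k, l = k + 1 := ⟨l - 1, by omega⟩
    rw [hr, List.range_succ_eq_map]
    simp [h0]
  refine ⟨r, ⟨?_, ?_, ?_, ?_, ?_⟩, fun t => ?_⟩
  · rw [← List.length_pos_iff]; omega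
  · intro a ha
    rw [hr, List.mem_map] at ha
    obtain ⟨t, ht, rfl⟩ := ha
    have := (hl t).1 (List.mem_range.1 ht)
    omega
  · rw [hr, List.pairwise_map]
    refine List.pairwise_lt_range.imp fun {s t} hst => ?_
    have := level_antitone m h hst.le
    omega
  · omega
  · omega
  · rw [rowHeight, hhead]
    have h3 := hm.level_eq_zero_iff hs t
    split_ifs with h4
    · by_cases h5 : t < l
      · rw [List.getD_eq_getElem _ _ (by simpa [hlen] using h5)]
        simp [hr]
      · rw [List.getD_eq_default _ _ (by simpa [hlen] using h5)]
        rw [hl] at h5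
        omega
    · omega

theorem exists_isRows (hm : IsConfig n m) :
    ∃ D, IsRows n D ∧ ∀ p, Cell n p → m p = rowsConfig D p := by
  have : ∀ h, ∃ r, IsStart n m h → IsRow n r ∧ ∀ t : ℕ, rowHeight r t = (level m h t : ℤ) - 1 := by
    intro h
    by_cases hs : IsStart n m h
    · obtain ⟨r, hr⟩ := hm.exists_row hs
      exact ⟨r, fun _ => hr⟩
    · exact ⟨[], fun h => absurd h hs⟩
  choose r hrow hr using this
  classical
  -- Reversal puts the starting heights in decreasing order, as `Above` requires.
  let D := (((List.range (n + 1)).filter fun h => decide (IsStart n m h)).reverse).map r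
  have hmem : ∀ s, s ∈ D ↔ ∃ h, IsStart n m h ∧ r h = s := by
    intro s
    simp only [D, List.mem_map, List.mem_reverse, List.mem_filter, List.mem_range, decide_eq_true_eq]
    constructor
    · rintro ⟨h, ⟨-, h1⟩, h2⟩
      exact ⟨h, h1, h2⟩
    · rintro ⟨h, h1, h2⟩
      exact ⟨h, ⟨Nat.lt_succ_of_le h1.2.1, h1⟩, h2⟩
  have hD : IsRows n D := by
    constructor
    · intro s hs
      obtain ⟨h, h1, rfl⟩ := (hmem s).1 hs
      exact hrow h h1
    · simp only [D, List.pairwise_map, List.pairwise_reverse]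
      refine (List.pairwise_lt_range.filter _).imp_of_mem ?_
      intro h' h ha hb hlt t ht h0
      have hs' : IsStart n m h' := by simpa using (List.mem_filter.1 ha).2
      have hs : IsStart n m h := by simpa using (List.mem_filter.1 hb).2
      lift t to ℕ using ht
      have h1 := hr h' hs' t
      have h2 := hr h hs (t + 1)
      push_cast at h2
      have := hm.level_lt_level_succ hs hs' hlt (t := t) (by omega)
      omega
  refine ⟨D, hD, ?_⟩
  rintro ⟨x, y⟩ hp
  have hp' := hp
  simp only [Cell] at hp'
  lift x to ℕ using hp'.1
  lift y to ℕ using hp'.2.2.1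
  by_cases hH : HasHorizontal D (x, y)
  · rw [IsRows.rowsConfig_eq_horizontal.2 hH]
    obtain ⟨s, hs, h1⟩ := hH
    obtain ⟨h, h2, rfl⟩ := (hmem s).1 hs
    have h3 := hr h h2 (x + 1)
    push_cast at h3
    exact hm.level_horizontal h2 (by simp only at h1; omega)
  by_cases hV : HasRising D (x, y)
  · rw [(hD.rowsConfig_eq_rising hp).2 hV]
    obtain ⟨s, hs, h1, h1'⟩ := hV
    obtain ⟨h, h2, rfl⟩ := (hmem s).1 hs
    have h3 := hr h h2 (x + 1)
    have h4 := hr h h2 x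
    push_cast at h3
    simp only at h1 h1'
    exact eq_rising_of_dropTo_le (c := level m h x)
      (show level m h (x + 1) ≤ y by omega) (by omega)
  · rw [IsRows.rowsConfig_eq_falling.2 ⟨hH, hV⟩]
    by_contra h1
    obtain ⟨h, h2, h3, h4⟩ := hm.exists_level hp ((hm.covered _ hp).resolve_left h1)
    have h5 := hr h h2 (x + 1)
    have h6 := hr h h2 x
    push_cast at h5
    have hs : r h ∈ D := (hmem _).2 ⟨h, h2, rfl⟩
    rcases eq_or_lt_of_le h3 with h7 | h7
    · exact hH ⟨r h, hs, by simp only; omega⟩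
    · exact hV ⟨r h, hs, by simp only; omega, by simp only; omega⟩

end IsConfig

/-! ### The path of a row -/

/-- The lattice points `(x, b), (x, b - 1), …, (x, b - k)`. -/
def column (x b : ℤ) : ℕ → List Pt
  | 0 => [(x, b)]
  | k + 1 => (x, b) :: column x (b - 1) k

/-- The lattice path which enters each of the columns `x, …, x + k` at the height given by `f`, and
ends at `(x + k, 0)`. -/
def pathFrom (f : ℤ → ℤ) (x : ℤ) : ℕ → List Pt
  | 0 => column x (f x) (f x).toNat
  | k + 1 => column x (f x) (f x - f (x + 1)).toNat ++ pathFrom f (x + 1) k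

/-- The lattice path described by a row. -/
def rowPath (r : List ℤ) : List Pt := pathFrom (rowHeight r) 0 (r.headD 0 - 2).toNat

theorem column_eq_cons (x b : ℤ) (k : ℕ) : ∃ l, column x b k = (x, b) :: l := by
  cases k <;> simp [column]

theorem getLast?_column (x b : ℤ) (k : ℕ) : (column x b k).getLast? = some (x, b - k) := by
  induction k generalizing b with
  | zero => simp [column]
  | succ k ih =>
    rw [column, List.getLast?_cons, ih]
    simp; ring

theorem mem_column {x b : ℤ} {k : ℕ} {p : Pt} (h : p ∈ column x b k) :
    p.1 = x ∧ b - k ≤ p.2 ∧ p.2 ≤ b := by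
  induction k generalizing b with
  | zero =>
    obtain rfl := List.mem_singleton.1 h
    simp
  | succ k ih =>
    rcases List.mem_cons.1 h with rfl | h
    · simp only [true_and]; omega
    · have := ih h
      push_cast
      omega

theorem isChain_column {R : Pt → Pt → Prop} (x b : ℤ) (k : ℕ)
    (h : ∀ y, b - k < y → y ≤ b → R (x, y) (x, y - 1)) : (column x b k).IsChain R := by
  induction k generalizing b with
  | zero => exact .singleton _
  | succ k ih =>
    rw [column, List.isChain_cons]
    refine ⟨?_, ih _ fun y h1 h2 => h y (by push_cast; omega) (by omega)⟩
    obtain ⟨l, hl⟩ := column_eq_cons x (b - 1) k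
    rw [hl]
    intro y hy
    obtain rfl := Option.some.inj hy
    exact h b (by push_cast; omega) le_rfl

theorem stepHeights_column (x b : ℤ) (k : ℕ) : stepHeights (column x b k) = [] := by
  induction k generalizing b with
  | zero => rfl
  | succ k ih =>
    have h := ih (b - 1)
    obtain ⟨l, hl⟩ := column_eq_cons x (b - 1) k
    rw [column]
    rw [hl] at h ⊢
    rw [stepHeights, if_neg (by simp), h]

theorem stepHeights_column_append (x b x' c : ℤ) (k : ℕ) (l : List Pt) (hc : c = b - k) :
    stepHeights (column x b k ++ (x', c) :: l) = c :: stepHeights ((x', c) :: l) := by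
  subst hc
  induction k generalizing b with
  | zero => simp [column, stepHeights]
  | succ k ih =>
    have h := ih (b - 1)
    obtain ⟨l', hl⟩ := column_eq_cons x (b - 1) k
    have e : b - ((k + 1 : ℕ) : ℤ) = b - 1 - k := by push_cast; ring
    rw [column, e]
    rw [hl, List.cons_append] at h
    rw [hl, List.cons_append, List.cons_append, stepHeights, if_neg (by simp), h]

theorem pathFrom_eq_cons (f : ℤ → ℤ) (x : ℤ) (k : ℕ) : ∃ l, pathFrom f x k = (x, f x) :: l := by
  cases k with
  | zero => exact column_eq_cons _ _ _
  | succ k =>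
    obtain ⟨l, hl⟩ := column_eq_cons x (f x) (f x - f (x + 1)).toNat
    rw [pathFrom, hl]
    exact ⟨_, rfl⟩

namespace IsRow
variable {n : ℕ} {r : List ℤ}

theorem rowHeight_succ_le (h : IsRow n r) {x : ℤ} (hx : 0 ≤ x) : rowHeight r (x + 1) ≤ rowHeight r x :=
  h.rowHeight_antitone hx (by omega)

theorem getLast?_pathFrom (h : IsRow n r) {x : ℤ} {k : ℕ} (hx : 0 ≤ x) (hk : x + k = r.headD 0 - 2) :
    (pathFrom (rowHeight r) x k).getLast? = some (r.headD 0 - 2, 0) := by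
  induction k generalizing x with
  | zero =>
    have := (h.rowHeight_nonneg_iff hx).2 (by omega)
    rw [pathFrom, getLast?_column]
    simp only [Option.some.injEq, Prod.mk.injEq]
    omega
  | succ k ih =>
    have := ih (x := x + 1) (by omega) (by push_cast at hk; omega)
    rw [pathFrom, List.getLast?_append, this]
    rfl

theorem mem_pathFrom (h : IsRow n r) {x : ℤ} {k : ℕ} (hx : 0 ≤ x) (hk : x + k = r.headD 0 - 2) {p : Pt}
    (hp : p ∈ pathFrom (rowHeight r) x k) :
    0 ≤ p.1 ∧ 0 ≤ p.2 ∧ rowHeight r (p.1 + 1) ≤ p.2 ∧ p.2 ≤ rowHeight r p.1 := by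
  induction k generalizing x with
  | zero =>
    have h1 := (h.rowHeight_nonneg_iff hx).2 (by omega)
    have h2 := h.rowHeight_nonneg_iff (t := x + 1) (by omega)
    obtain ⟨rfl, h3, h4⟩ := mem_column hp
    omega
  | succ k ih =>
    push_cast at hk
    rw [pathFrom, List.mem_append] at hp
    rcases hp with hp | hp
    · have h1 := h.rowHeight_succ_le hx
      have h2 := (h.rowHeight_nonneg_iff (t := x + 1) (by omega)).2 (by omega)
      obtain ⟨rfl, h3, h4⟩ := mem_column hp
      omega
    · exact ih (by omega) (by omega) hp

theorem isChain_pathFrom (h : IsRow n r) {R : Pt → Pt → Prop}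
    (hH : ∀ x y, 0 ≤ x → 0 ≤ y → rowHeight r (x + 1) = y → R (x, y) (x + 1, y))
    (hV : ∀ x y, 0 ≤ x → 0 < y → rowHeight r (x + 1) < y → y ≤ rowHeight r x →
      R (x, y) (x, y - 1))
    {x : ℤ} {k : ℕ} (hx : 0 ≤ x) (hk : x + k = r.headD 0 - 2) :
    (pathFrom (rowHeight r) x k).IsChain R := by
  induction k generalizing x with
  | zero =>
    have h1 := (h.rowHeight_nonneg_iff hx).2 (by omega)
    have h2 := h.rowHeight_nonneg_iff (t := x + 1) (by omega)
    exact isChain_column _ _ _ fun y h3 h4 => hV x y hx (by omega) (by omega) h4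
  | succ k ih =>
    push_cast at hk
    have h1 := h.rowHeight_succ_le hx
    have h2 := (h.rowHeight_nonneg_iff (t := x + 1) (by omega)).2 (by omega)
    rw [pathFrom, List.isChain_append]
    refine ⟨isChain_column _ _ _ fun y h3 h4 => hV x y hx (by omega) (by omega) h4,
      ih (by omega) (by omega), ?_⟩
    obtain ⟨l, hl⟩ := pathFrom_eq_cons (rowHeight r) (x + 1) k
    rw [getLast?_column, hl]
    intro p hp q hq
    obtain rfl := Option.some.inj hp
    obtain rfl := Option.some.inj hq
    rw [show rowHeight r x - ((rowHeight r x - rowHeight r (x + 1)).toNat : ℤ) =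
      rowHeight r (x + 1) by omega]
    exact hH _ _ hx h2 rfl

theorem stepHeights_pathFrom (h : IsRow n r) {x : ℤ} {k : ℕ} (hx : 0 ≤ x) (hk : x + k = r.headD 0 - 2) :
    stepHeights (pathFrom (rowHeight r) x k) =
      (List.range k).map fun j : ℕ => rowHeight r (x + j + 1) := by
  induction k generalizing x with
  | zero => exact stepHeights_column _ _ _
  | succ k ih =>
    push_cast at hk
    have h1 := h.rowHeight_succ_le hx
    have h3 := ih (x := x + 1) (by omega) (by omega)
    obtain ⟨l, hl⟩ := pathFrom_eq_cons (rowHeight r) (x + 1) k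
    rw [hl] at h3
    rw [pathFrom, hl, stepHeights_column_append _ _ _ _ _ _ (by omega), h3,
      List.range_succ_eq_map, List.map_cons, List.map_map]
    congr 1
    · simp
    · refine List.map_congr_left fun j _ => ?_
      simp only [Function.comp, Nat.succ_eq_add_one]
      push_cast
      congr 1
      ring

theorem natCast_toNat_sub (h : IsRow n r) : (0 : ℤ) + (r.headD 0 - 2).toNat = r.headD 0 - 2 := by
  have := h.two_le
  omega

theorem head?_rowPath (h : IsRow n r) : (rowPath r).head? = some (0, r.headD 0) := by
  obtain ⟨l, hl⟩ := pathFrom_eq_cons (rowHeight r) 0 (r.headD 0 - 2).toNat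
  rw [rowPath, hl, h.rowHeight_zero]
  rfl

theorem startHeight_rowPath (h : IsRow n r) : startHeight (rowPath r) = r.headD 0 := by
  obtain ⟨l, hl⟩ := pathFrom_eq_cons (rowHeight r) 0 (r.headD 0 - 2).toNat
  rw [rowPath, hl, h.rowHeight_zero]
  rfl

theorem readRow_rowPath (h : IsRow n r) : readRow (rowPath r) = r := by
  have h2 := h.two_le
  have hlt := h.length_lt
  rw [readRow, h.startHeight_rowPath, rowPath, h.stepHeights_pathFrom le_rfl h.natCast_toNat_sub]
  -- The heights read off the path are the entries of `r` padded with zeros to length `r.headD 0 -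
  -- 1`; the filter removes exactly the padding.
  have key : (r.headD 0 :: (List.range (r.headD 0 - 2).toNat).map
      fun j : ℕ => rowHeight r (0 + j + 1)) =
      r ++ List.replicate ((r.headD 0 - 1).toNat - r.length) 0 := by
    apply List.ext_getElem
    · simp [-List.headD_eq_head?_getD]; omega
    · intro i h3 h4
      have h5 : (r.headD 0 :: (List.range (r.headD 0 - 2).toNat).map
          fun j : ℕ => rowHeight r (0 + j + 1))[i] = rowHeight r i := by
        cases i with
        | zero => exact h.rowHeight_zero.symm
        | succ i => simp
      simp only [List.length_cons, List.length_map, List.length_range] at h3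
      rw [h5]
      by_cases h6 : i < r.length
      · rw [List.getElem_append_left h6, h.rowHeight_of_lt (by omega) (by simpa)]
        rfl
      · rw [List.getElem_append_right (by omega), List.getElem_replicate,
          rowHeight_of_ge (by simp; omega) (by omega)]
  rw [key, List.filter_append, List.filter_eq_self.2 (by simpa using h.pos),
    List.filter_eq_nil_iff.2, List.append_nil]
  intro a ha
  rw [List.eq_of_mem_replicate ha]
  simp

end IsRow

/-! ### The paths of a tiling -/

theorem Step.snd_le {S : Finset Rhombus} {a b : Pt} (h : Step S a b) : b.2 ≤ a.2 := by
  rcases h with ⟨rfl, -⟩ | ⟨rfl, -⟩ <;> simp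

theorem snd_le_of_isChain {S : Finset Rhombus} {a b : Pt} {l : List Pt}
    (h : (a :: l).IsChain (Step S)) (hb : (a :: l).getLast? = some b) : b.2 ≤ a.2 := by
  induction l generalizing a with
  | nil =>
    obtain rfl : a = b := by simpa using hb
    exact le_rfl
  | cons c l ih =>
    rw [List.isChain_cons_cons] at h
    rw [List.getLast?_cons_cons] at hb
    exact (ih h.2 hb).trans h.1.snd_le

/-- Steps are forced, and the one at `(x, 0)` leads to height `-1`, from which no step leads up
again. So a path cannot pass through a possible endpoint and end at another one. -/
theorem not_isChain_of_rising {S : Finset Rhombus}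
    (hS : ∀ a b b', Step S a b → Step S a b' → b = b') {x x' : ℤ} {c : Pt} {l : List Pt}
    (hr : (⟨.rising, (x, 0)⟩ : Rhombus) ∈ S) (h : ((x, 0) :: c :: l).IsChain (Step S)) :
    ((x, 0) :: c :: l).getLast? ≠ some (x', 0) := by
  intro hb
  rw [List.isChain_cons_cons] at h
  rw [List.getLast?_cons_cons] at hb
  obtain rfl := hS _ _ _ h.1 (.inr ⟨rfl, hr⟩)
  have := snd_le_of_isChain h.2 hb
  simp at this

theorem isChain_step_unique {S : Finset Rhombus}
    (hS : ∀ a b b', Step S a b → Step S a b' → b = b') {l l' : List Pt}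
    (h : l.IsChain (Step S)) (h' : l'.IsChain (Step S)) (hh : l.head? = l'.head?) {x x' : ℤ}
    (hl : l.getLast? = some (x, 0)) (hl' : l'.getLast? = some (x', 0))
    (hx : (⟨.rising, (x, 0)⟩ : Rhombus) ∈ S) (hx' : (⟨.rising, (x', 0)⟩ : Rhombus) ∈ S) :
    l = l' := by
  induction l generalizing l' with
  | nil => simp at hl
  | cons a l ih =>
    cases l' with
    | nil => simp at hl'
    | cons a' l' =>
      obtain rfl : a = a' := by simpa using hh
      cases l with
      | nil =>
        obtain rfl : a = (x, 0) := by simpa using hl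
        cases l' with
        | nil => rfl
        | cons c l' => exact absurd hl' (not_isChain_of_rising hS hx h')
      | cons c l =>
        cases l' with
        | nil =>
          obtain rfl : a = (x', 0) := by simpa using hl'
          exact absurd hl (not_isChain_of_rising hS hx' h)
        | cons c' l' =>
          rw [List.isChain_cons_cons] at h h'
          rw [List.getLast?_cons_cons] at hl hl'
          obtain rfl := hS _ _ _ h.1 h'.1
          rw [ih h.2 h'.2 rfl hl hl']

theorem IsTiling.step_unique {n : ℕ} {T : Finset Rhombus} (hT : IsTiling n T) (a b b' : Pt)
    (h : Step (restriction n T) a b) (h' : Step (restriction n T) a b') : b = b' := by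
  rcases h with ⟨rfl, h⟩ | ⟨rfl, h⟩ <;> rcases h' with ⟨rfl, h'⟩ | ⟨rfl, h'⟩
  · rfl
  · simpa using hT.orientation_unique (mem_restriction.1 h).1 (mem_restriction.1 h').1
  · simpa using hT.orientation_unique (mem_restriction.1 h).1 (mem_restriction.1 h').1
  · rfl

theorem IsPathFamily.unique {n : ℕ} {T : Finset Rhombus} {F G : List (List Pt)}
    (hF : IsPathFamily n T F) (hG : IsPathFamily n T G) : G = F :=
  List.Pairwise.eq_of_mem_iff hG.2 hF.2 fun P => (hG.1 P).trans (hF.1 P).symm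

/-! ### The tiling described by a family of rows -/

namespace IsRows
variable {n : ℕ} {D : List (List ℤ)} {T : Finset Rhombus}

theorem horizontal_mem_restriction (hD : IsRows n D) (hT : IsTiling n T)
    (hC : IsCyclicallySymmetric T) (hm : Represents n (rowsConfig D) T) (x y : ℤ) :
    (⟨.horizontal, (x, y)⟩ : Rhombus) ∈ restriction n T ↔
      -1 ≤ x ∧ 0 ≤ y ∧ ∃ r ∈ D, rowHeight r (x + 1) = y := by
  rw [hm.horizontal_mem_restriction hT hC]
  constructor
  · rintro ⟨h1, h2⟩
    rw [hD.fromLeft_iff h1] at h2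
    simp only [Cell, Prod.mk_add_mk, add_zero] at h1 h2
    exact ⟨by omega, by omega, h2⟩
  · rintro ⟨h1, h2, r, hr, h3⟩
    have hR := hD.row r hr
    have h4 := hR.rowHeight_le_headD (t := x + 1) (by omega)
    have h5 := (hR.rowHeight_nonneg_iff (t := x + 1) (by omega)).1 (by omega)
    have h6 := hR.le
    have hc : Cell n ((x, y) + (1, 0)) := by
      simp only [Cell, Prod.mk_add_mk, add_zero]; omega
    refine ⟨hc, ?_⟩
    rw [hD.fromLeft_iff hc]
    exact ⟨r, hr, by simpa using h3⟩

theorem rising_mem_restriction (hD : IsRows n D) (hT : IsTiling n T)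
    (hm : Represents n (rowsConfig D) T) (x y : ℤ) :
    (⟨.rising, (x, y)⟩ : Rhombus) ∈ restriction n T ↔
      0 ≤ x ∧ 0 ≤ y ∧ ∃ r ∈ D, rowHeight r (x + 1) < y ∧ y ≤ rowHeight r x := by
  rw [hm.rising_mem_restriction hT]
  constructor
  · rintro ⟨h1, h2⟩
    rw [hD.rowsConfig_eq_rising h1] at h2
    exact ⟨h1.1, h1.2.2.1, h2⟩
  · rintro ⟨h1, h2, r, hr, h3, h4⟩
    have hR := hD.row r hr
    have h5 := hR.rowHeight_le_headD h1
    have h6 := (hR.rowHeight_nonneg_iff h1).1 (by omega)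
    have h7 := hR.le
    have hc : Cell n (x, y) := by simp only [Cell]; omega
    exact ⟨hc, (hD.rowsConfig_eq_rising hc).2 ⟨r, hr, h3, h4⟩⟩

theorem startsAt_rowPath (hD : IsRows n D) (hT : IsTiling n T) (hC : IsCyclicallySymmetric T)
    (hm : Represents n (rowsConfig D) T) {r : List ℤ} (hr : r ∈ D) :
    StartsAt n T (rowPath r) (r.headD 0) := by
  have hR := hD.row r hr
  have := hR.two_le
  refine ⟨hR.head?_rowPath, ?_⟩
  rw [hD.horizontal_mem_restriction hT hC hm]
  exact ⟨le_rfl, by omega, r, hr, hR.rowHeight_zero⟩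

theorem endsAt_rowPath (hD : IsRows n D) (hT : IsTiling n T)
    (hm : Represents n (rowsConfig D) T) {r : List ℤ} (hr : r ∈ D) :
    EndsAt n T (rowPath r) (r.headD 0 - 2) := by
  have hR := hD.row r hr
  have := hR.two_le
  refine ⟨hR.getLast?_pathFrom le_rfl hR.natCast_toNat_sub, ?_⟩
  rw [hD.rising_mem_restriction hT hm]
  have h1 := hR.rowHeight_nonneg_iff (t := r.headD 0 - 2) (by omega)
  have h2 := hR.rowHeight_nonneg_iff (t := r.headD 0 - 2 + 1) (by omega)
  exact ⟨by omega, le_rfl, r, hr, by omega, by omega⟩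

theorem isChain_rowPath (hD : IsRows n D) (hT : IsTiling n T) (hC : IsCyclicallySymmetric T)
    (hm : Represents n (rowsConfig D) T) {r : List ℤ} (hr : r ∈ D) :
    (rowPath r).IsChain (Step (restriction n T)) := by
  have hR := hD.row r hr
  refine hR.isChain_pathFrom ?_ ?_ le_rfl hR.natCast_toNat_sub
  · intro x y hx hy h
    refine .inl ⟨by simp, ?_⟩
    rw [hD.horizontal_mem_restriction hT hC hm]
    exact ⟨by omega, hy, r, hr, h⟩
  · intro x y hx hy h h'
    refine .inr ⟨by simp, ?_⟩
    rw [hD.rising_mem_restriction hT hm]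
    exact ⟨hx, hy.le, r, hr, h, h'⟩

theorem exists_row_of_horizontal (hD : IsRows n D) (hT : IsTiling n T)
    (hC : IsCyclicallySymmetric T) (hm : Represents n (rowsConfig D) T) {h : ℤ}
    (h1 : (⟨.horizontal, (-1, h)⟩ : Rhombus) ∈ restriction n T) : ∃ r ∈ D, r.headD 0 = h := by
  rw [hD.horizontal_mem_restriction hT hC hm] at h1
  obtain ⟨-, -, r, hr, h2⟩ := h1
  rw [neg_add_cancel, (hD.row r hr).rowHeight_zero] at h2
  exact ⟨r, hr, h2⟩

theorem isPathFamily (hD : IsRows n D) (hT : IsTiling n T) (hC : IsCyclicallySymmetric T)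
    (hm : Represents n (rowsConfig D) T) : IsPathFamily n T (D.map rowPath) := by
  constructor
  · intro P
    rw [List.mem_map]
    constructor
    · rintro ⟨r, hr, rfl⟩
      exact ⟨hD.isChain_rowPath hT hC hm hr, ⟨_, hD.startsAt_rowPath hT hC hm hr⟩,
        ⟨_, hD.endsAt_rowPath hT hm hr⟩⟩
    · rintro ⟨h1, ⟨h, h2, h3⟩, x, h4, h5⟩
      obtain ⟨r, hr, rfl⟩ := hD.exists_row_of_horizontal hT hC hm h3
      obtain ⟨h6, h7⟩ := hD.endsAt_rowPath hT hm hr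
      refine ⟨r, hr, isChain_step_unique hT.step_unique (hD.isChain_rowPath hT hC hm hr) h1 ?_
        h6 h4 h7 h5⟩
      rw [h2, (hD.row r hr).head?_rowPath]
  · rw [List.pairwise_map]
    refine hD.above.imp_of_mem fun {r r'} hr hr' h => ?_
    rw [(hD.row r hr).startHeight_rowPath, (hD.row r' hr').startHeight_rowPath]
    exact (hD.row r hr).above_headD (hD.row r' hr') h

theorem nonIntersecting (hD : IsRows n D) : NonIntersecting (D.map rowPath) := by
  rw [NonIntersecting, List.pairwise_map]
  refine hD.above.imp_of_mem fun {r r'} hr hr' h a ha ha' => ?_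
  have hR := hD.row r hr
  have hR' := hD.row r' hr'
  obtain ⟨h1, h2, h3, h4⟩ := hR.mem_pathFrom le_rfl hR.natCast_toNat_sub ha
  obtain ⟨-, -, h5, h6⟩ := hR'.mem_pathFrom le_rfl hR'.natCast_toNat_sub ha'
  have := h a.1 h1 (by omega)
  omega

/-- By symmetry the rhombus at `(x, 0)` is matched with one cut by the left border at height `x +
2`, and the path starting there ends at `x`. -/
theorem exists_endsAt (hD : IsRows n D) (hT : IsTiling n T)
    (hC : IsCyclicallySymmetric T) (hm : Represents n (rowsConfig D) T) {x : ℤ}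
    (h : (⟨.rising, (x, 0)⟩ : Rhombus) ∈ restriction n T) :
    ∃ P ∈ D.map rowPath, EndsAt n T P x := by
  have h0 := (hm.rising_mem_restriction hT _).1 h
  have h1 : (⟨.horizontal, (-1, x + 2)⟩ : Rhombus) ∈ T := by
    rw [hC.left_border, add_sub_cancel_right]
    exact (mem_restriction.1 h).1
  have h2 : (⟨.horizontal, (-1, x + 2)⟩ : Rhombus) ∈ restriction n T := by
    rw [mem_restriction]
    refine ⟨h1, .right (0, x + 2), by simp [Rhombus.triangles], ?_⟩
    rw [inFundamental_right]
    have := h0.1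
    simp only [Cell] at this ⊢
    omega
  obtain ⟨r, hr, h3⟩ := hD.exists_row_of_horizontal hT hC hm h2
  refine ⟨_, List.mem_map_of_mem hr, ?_⟩
  have := hD.endsAt_rowPath hT hm hr
  rwa [h3, add_sub_cancel_right] at this

theorem map_readRow (hD : IsRows n D) : (D.map rowPath).map readRow = D := by
  rw [List.map_map]
  conv_rhs => rw [← List.map_id D]
  exact List.map_congr_left fun r hr => (hD.row r hr).readRow_rowPath

end IsRows

/-! ### Counting horizontal rhombi -/

/-- The horizontal rhombi described by the entries of the rows `D`. -/
def entryTiles (D : List (List ℤ)) : List Rhombus :=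
  D.flatMap fun r => r.zipIdx.map fun e => ⟨.horizontal, ((e.2 : ℤ) - 1, e.1)⟩

namespace IsRows
variable {n : ℕ} {D : List (List ℤ)} {T : Finset Rhombus}

theorem mem_entryTiles (hD : IsRows n D) (hT : IsTiling n T) (hC : IsCyclicallySymmetric T)
    (hm : Represents n (rowsConfig D) T) (ρ : Rhombus) :
    ρ ∈ entryTiles D ↔ ρ.orientation = .horizontal ∧ 0 < ρ.corner.2 ∧ ρ ∈ restriction n T := by
  simp only [entryTiles, List.mem_flatMap, List.mem_map, List.mem_zipIdx_iff_getElem?, Prod.exists]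
  constructor
  · rintro ⟨r, hr, a, t, h1, rfl⟩
    obtain ⟨h2, h3⟩ := List.getElem?_eq_some_iff.1 h1
    have hR := hD.row r hr
    have h4 := hR.pos a (h3 ▸ List.getElem_mem h2)
    refine ⟨rfl, h4, ?_⟩
    rw [hD.horizontal_mem_restriction hT hC hm]
    refine ⟨by omega, h4.le, r, hr, ?_⟩
    rw [sub_add_cancel, hR.rowHeight_of_lt (by omega) (by simpa using h2)]
    exact h3
  · obtain ⟨o, x, y⟩ := ρ
    rintro ⟨h1, h2, h3⟩
    obtain rfl : o = .horizontal := h1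
    simp only at h2
    obtain ⟨h4, -, r, hr, h5⟩ := (hD.horizontal_mem_restriction hT hC hm x y).1 h3
    have hR := hD.row r hr
    have h6 := (hR.rowHeight_pos_iff (t := x + 1) (by omega)).1 (by omega)
    rw [hR.rowHeight_of_lt (by omega) h6] at h5
    refine ⟨r, hr, y, (x + 1).toNat, List.getElem?_eq_some_iff.2 ⟨h6, h5⟩, ?_⟩
    simp only [Rhombus.mk.injEq, Prod.mk.injEq, true_and, and_true]
    omega

/-- Within a row the positions differ; two rows with the same entry at the same position would
violate `Above`. Counting entries is therefore counting rhombi. -/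
theorem nodup_entryTiles (hD : IsRows n D) : (entryTiles D).Nodup := by
  refine List.nodup_flatMap.2 ⟨fun r _ => ?_, hD.above.imp_of_mem fun {r r'} hr hr' h => ?_⟩
  · refine List.Nodup.map ?_ (List.Nodup.of_map Prod.snd ?_)
    · rintro ⟨a, t⟩ ⟨b, s⟩ h
      simp only [Rhombus.mk.injEq, Prod.mk.injEq, true_and] at h ⊢
      omega
    · rw [List.zipIdx_map_snd]
      exact List.nodup_range'
  · intro ρ h1 h2
    simp only [List.mem_map, List.mem_zipIdx_iff_getElem?, Prod.exists] at h1 h2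
    obtain ⟨a, t, h3, rfl⟩ := h1
    obtain ⟨b, s, h4, h5⟩ := h2
    simp only [Rhombus.mk.injEq, Prod.mk.injEq, true_and] at h5
    obtain rfl : s = t := by omega
    obtain rfl : b = a := h5.2
    have hR := hD.row r hr
    have hR' := hD.row r' hr'
    obtain ⟨h6, h7⟩ := List.getElem?_eq_some_iff.1 h3
    obtain ⟨h8, h9⟩ := List.getElem?_eq_some_iff.1 h4
    have h10 : rowHeight r s = b := (hR.rowHeight_of_lt (by omega) (by simpa using h6)).trans h7
    have h11 : rowHeight r' s = b := (hR'.rowHeight_of_lt (by omega) (by simpa using h8)).trans h9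
    have h12 := hR.pos b (h7 ▸ List.getElem_mem h6)
    have h13 := h s (by omega) (by omega)
    have h14 := hR.rowHeight_succ_le (x := s) (by omega)
    omega

theorem card_eq_sum (hD : IsRows n D) {A : Finset Rhombus} (q : Rhombus → Bool)
    (hA : ∀ ρ, ρ ∈ A ↔ ρ ∈ entryTiles D ∧ q ρ) :
    A.card = (D.map fun r => r.zipIdx.countP fun e =>
      q ⟨.horizontal, ((e.2 : ℤ) - 1, e.1)⟩).sum := by
  have h1 : A = ((entryTiles D).filter q).toFinset := by
    ext ρ
    rw [hA, List.mem_toFinset, List.mem_filter]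
  rw [h1, List.toFinset_card_of_nodup (hD.nodup_entryTiles.filter _), ← List.countP_eq_length_filter,
    entryTiles, List.countP_flatMap]
  congr 1
  refine List.map_congr_left fun r _ => ?_
  simp only [Function.comp, List.countP_map]
  rfl

theorem forall_vertices_horizontal (x y : ℤ) (Q : Pt → Prop) :
    (∀ p ∈ (⟨.horizontal, (x, y)⟩ : Rhombus).vertices, Q p) ↔
      Q (x, y) ∧ Q (x + 1, y) ∧ Q (x + 1, y + 1) ∧ Q (x + 2, y + 1) := by
  simp [mem_vertices_horizontal]

theorem countP_zipIdx_fst (r : List ℤ) (q : ℤ → Bool) :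
    (r.zipIdx.countP fun e => q e.1) = r.countP q := by
  conv_rhs => rw [← List.zipIdx_map_fst 0 r, List.countP_map]
  rfl

theorem statR_eq (hD : IsRows n D) (hn : 1 ≤ n) (hT : IsTiling n T)
    (hC : IsCyclicallySymmetric T) (hm : Represents n (rowsConfig D) T) :
    statR n D = topStripCount n T := by
  rw [topStripCount, hD.card_eq_sum fun ρ => decide (ρ.corner.2 = n)]
  · rw [statR]
    congr 1
    refine List.map_congr_left fun r _ => ?_
    rw [List.count, countP_zipIdx_fst r fun a => decide (a = n)]
    refine List.countP_congr fun a _ => ?_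
    simp
  · intro ρ
    rw [hD.mem_entryTiles hT hC hm, Finset.mem_filter]
    obtain ⟨o, x, y⟩ := ρ
    cases o
    · rw [forall_vertices_horizontal]
      simp only [decide_eq_true_eq, true_and]
      constructor
      · rintro ⟨h1, h2⟩
        -- Cells have height at most `n`, so lying in the top strip means corner height exactly `n`,
        -- which is positive by `hn`.
        have h3 := (hm.horizontal_mem_restriction hT hC _).1 h1
        simp only [Cell, Prod.mk_add_mk] at h3
        exact ⟨⟨by omega, h1⟩, by omega⟩
      · rintro ⟨⟨h1, h2⟩, h3⟩
        exact ⟨h2, by omega⟩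
    · simp
    · simp

theorem statI_eq (hD : IsRows n D) (hT : IsTiling n T)
    (hC : IsCyclicallySymmetric T) (hm : Represents n (rowsConfig D) T) :
    statI D = regionCount n T := by
  rw [regionCount, hD.card_eq_sum fun _ => true]
  · simp [statI]
  · intro ρ
    simp only [hD.mem_entryTiles hT hC hm, Finset.mem_filter]
    obtain ⟨o, x, y⟩ := ρ
    cases o
    · rw [forall_vertices_horizontal]
      simp only [true_and, and_true]
      constructor
      · rintro ⟨h1, h2⟩
        exact ⟨by omega, h1⟩
      · rintro ⟨h1, h2⟩
        exact ⟨h2, by omega⟩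
    · simp
    · simp

theorem statS_eq (hD : IsRows n D) (hT : IsTiling n T)
    (hC : IsCyclicallySymmetric T) (hm : Represents n (rowsConfig D) T) :
    statS D = wedgeCount T := by
  rw [wedgeCount, hD.card_eq_sum fun ρ => decide (ρ.corner.2 ≤ ρ.corner.1 + 1)]
  · simp [statS]
  · intro ρ
    rw [hD.mem_entryTiles hT hC hm, Finset.mem_filter]
    obtain ⟨o, x, y⟩ := ρ
    cases o
    · rw [forall_vertices_horizontal]
      simp only [decide_eq_true_eq, true_and]
      constructor
      · rintro ⟨h1, h2⟩
        -- The wedge forces `1 ≤ y` and `0 ≤ x`, so a rhombus of `T` in it has its left triangle in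
        -- the fundamental region and counting in `T` or in the restriction is the same.
        have h3 := (hT.horizontal_region h1).1
        rw [inRegion_left] at h3
        refine ⟨⟨by omega, ?_⟩, by omega⟩
        rw [mem_restriction]
        refine ⟨h1, .left (x, y), by simp [Rhombus.triangles], ?_⟩
        rw [inFundamental_left]
        simp only [Cell]
        omega
      · rintro ⟨⟨h1, h2⟩, h3⟩
        exact ⟨(mem_restriction.1 h2).1, by omega⟩
    · simp
    · simp

/-- A tiling determines the rows of which it consists. -/
theorem eq_of_represents {D' : List (List ℤ)} (hD : IsRows n D) (hD' : IsRows n D')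
    (hT : IsTiling n T) (hC : IsCyclicallySymmetric T) (hm : Represents n (rowsConfig D) T)
    (hm' : Represents n (rowsConfig D') T) : D = D' := by
  rw [← hD.map_readRow, ← hD'.map_readRow,
    (hD'.isPathFamily hT hC hm').unique (hD.isPathFamily hT hC hm)]

end IsRows

/-! ### The bijection and the theorem -/

theorem CSTiling.exists_isRows {n : ℕ} (T : CSTiling n) :
    ∃ D, IsRows n D ∧ Represents n (rowsConfig D) T.1 := by
  obtain ⟨m, hm⟩ := exists_represents T.2.1
  obtain ⟨D, hD, h⟩ := (hm.isConfig T.2.1 T.2.2).exists_isRows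
  refine ⟨D, hD, fun p hp o => ?_⟩
  rw [← h p hp]
  exact hm p hp o

/-- The bijection from cyclically symmetric tilings to descending plane partitions. -/
theorem exists_equiv_represents (n : ℕ) : ∃ Φ : CSTiling n ≃ DPP n,
    ∀ T : CSTiling n, IsRows n (Φ T).1 ∧ Represents n (rowsConfig (Φ T).1) T.1 := by
  choose D hD hm using fun T : CSTiling n => T.exists_isRows
  let f : CSTiling n → DPP n := fun T => ⟨D T, isDescending_iff_isRows.2 (hD T)⟩
  have hf : Function.Bijective f := by
    constructor
    · intro T T' h
      have h1 : D T = D T' := congrArg Subtype.val h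
      have h2 := hm T'
      rw [← h1] at h2
      exact Subtype.ext ((hm T).tiling_unique h2 T.2.1 T'.2.1 T.2.2 T'.2.2)
    · rintro ⟨E, hE⟩
      have hE' := isDescending_iff_isRows.1 hE
      -- The tiling built from `E` represents both `E` and `D T`; the two agree since the path
      -- family of a tiling, and so its rows, are unique.
      let T : CSTiling n := ⟨configTiling n (rowsConfig E), hE'.isConfig.isTiling,
        configTiling_isCyclicallySymmetric n _⟩
      exact ⟨T, Subtype.ext ((hD T).eq_of_represents hE' T.2.1 T.2.2 (hm T)
        (configTiling_represents n _))⟩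
  exact ⟨Equiv.ofBijective f hf, fun T => ⟨hD T, hm T⟩⟩

end DescendingPP

open DescendingPP
theorem mainTheorem1 (n : ℕ) (hn : 1 ≤ n) :
    ∃ Φ : CSTiling n ≃ DPP n, ∀ T : CSTiling n,
      (∃ F : List (List Pt),
        IsPathFamily n T.1 F ∧ (∀ G, IsPathFamily n T.1 G → G = F) ∧
        NonIntersecting F ∧
        (∀ P ∈ F, ∃ x : ℤ, 0 ≤ x ∧ StartsAt n T.1 P (x + 2) ∧ EndsAt n T.1 P x) ∧
        (∀ h : ℤ, (⟨.horizontal, (-1, h)⟩ : Rhombus) ∈ restriction n T.1 →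
          ∃ P ∈ F, StartsAt n T.1 P h) ∧
        (∀ x : ℤ, (⟨.rising, (x, 0)⟩ : Rhombus) ∈ restriction n T.1 →
          ∃ P ∈ F, EndsAt n T.1 P x) ∧
        (Φ T).1 = F.map readRow) ∧
      statR n (Φ T).1 = topStripCount n T.1 ∧
      statS (Φ T).1 = wedgeCount T.1 ∧
      statI (Φ T).1 = regionCount n T.1 := by
  obtain ⟨Φ, hΦ⟩ := exists_equiv_represents n
  refine ⟨Φ, fun T => ?_⟩
  obtain ⟨hD, hm⟩ := hΦ T
  have hT := T.2.1
  have hC := T.2.2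
  refine ⟨⟨(Φ T).1.map rowPath, hD.isPathFamily hT hC hm, fun G hG =>
    (hD.isPathFamily hT hC hm).unique hG, hD.nonIntersecting, ?_, ?_,
    fun x hx => hD.exists_endsAt hT hC hm hx, hD.map_readRow.symm⟩,
    hD.statR_eq hn hT hC hm, hD.statS_eq hT hC hm, hD.statI_eq hT hC hm⟩
  · intro P hP
    obtain ⟨r, hr, rfl⟩ := List.mem_map.1 hP
    have h1 := hD.startsAt_rowPath hT hC hm hr
    have h2 := (hD.row r hr).two_le
    exact ⟨r.headD 0 - 2, by omega, by rwa [sub_add_cancel], hD.endsAt_rowPath hT hm hr⟩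
  · intro h hh
    obtain ⟨r, hr, rfl⟩ := hD.exists_row_of_horizontal hT hC hm hh
    exact ⟨_, List.mem_map_of_mem hr, hD.startsAt_rowPath hT hC hm hr⟩
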